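/- Let $p$ be a prime and let $k$ be an algebraically closed field of characteristic $p$. Let $\sigma(A,B)=\sum_{i=1}^{p-1}\sigma_iA^iB^{p-i}$ with $\sigma_i\in k$ and $\sigma_1=\sigma_{p-1}=1$, and put $\sigma^{1/p}(A,B)=\sum_{i=1}^{p-1}\sigma_i^{1/p}A^iB^{p-i}$. Consider the pairs (a proper variety together with a reduced boundary divisor) $X=(\mathbb P^2,\Delta_X)$ with $\Delta_X=\{\sigma(x_0,x_1)-x_2^p=0\}$ and $Z=(\mathbb P(1,1,p),\Delta_Z)$ with $\Delta_Z=\{z_2=0\}$, where $z_0,z_1,z_2$ have weights $1,1,p$, and the morphism over $k$ $$F_{Z/X}\colon Z\to X,\qquad [z_0:z_1:z_2]\mapsto[z_0^p:z_1^p:\sigma^{1/p}(z_0,z_1)-z_2].$$ For such a pair $W$ with boundary $\Delta_W$, an $\mathbb A^1$-curve $f\colon\mathbb P^1_\infty\to W$ is a morphism over $k$ from $\mathbb P^1$, with marked point $\infty$, to the underlying variety of $W$ such that $f^{-1}(\Delta_W)=\{\infty\}$ as sets. Its contact order (at $\infty$) is $\deg f^*\Delta_W$. Then every $\mathbb A^1$-curve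 $f\colon\mathbb P^1_\infty\to X$ lifts to a unique $\mathbb A^1$-curve $\tilde f\colon\mathbb P^1_\infty\to Z$, i.e. there is exactly one $\mathbb A^1$-curve $\tilde f$ in $Z$ with $F_{Z/X}\circ\tilde f=f$. Furthermore, the contact order of $f$ is $p$ times the contact order of $\tilde f$; that is, if the contact order of $f$ is $pd$, then the contact order of $\tilde f$ is $d$. -/

import Mathlib

open AlgebraicGeometry CategoryTheory MvPolynomial

universe u

namespace A1Curves

noncomputable section

/-! ### Morphisms of `Proj` induced by graded maps that multiply degrees by a constant -/

section ProjMap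

open HomogeneousLocalization

variable {A B : Type u} [CommRing A] [CommRing B] {α β : Type*}
  [SetLike α A] [SetLike β B] {𝒜 : ℕ → α} {ℬ : ℕ → β}

lemma powers_le_comap (φ : A →+* B) (s : A) :
    Submonoid.powers s ≤ (Submonoid.powers (φ s)).comap φ := by
  rintro _ ⟨n, rfl⟩
  exact ⟨n, by simp⟩

/-- The underlying function of `awayMapMul`. -/
def awayMapMulFun {d : ℕ} (φ : A →+* B) (hφ : ∀ n, ∀ a ∈ 𝒜 n, φ a ∈ ℬ (d * n)) (s : A) :
    Away 𝒜 s → Away ℬ (φ s) :=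
  Quotient.map'
    (fun x ↦ ⟨d * x.deg, ⟨φ x.num, hφ _ _ x.num.2⟩, ⟨φ x.den, hφ _ _ x.den.2⟩,
      powers_le_comap φ s x.den_mem⟩)
    fun x y (e : x.embedding = y.embedding) ↦ by
      apply_fun IsLocalization.map (Localization (Submonoid.powers (φ s))) φ
        (powers_le_comap φ s) at e
      simp_rw [HomogeneousLocalization.NumDenSameDeg.embedding, Localization.mk_eq_mk',
        IsLocalization.map_mk', ← Localization.mk_eq_mk'] at e
      exact e

lemma val_awayMapMulFun {d : ℕ} (φ : A →+* B) (hφ : ∀ n, ∀ a ∈ 𝒜 n, φ a ∈ ℬ (d * n)) (s : A)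
    (x : Away 𝒜 s) :
    (awayMapMulFun φ hφ s x).val =
      IsLocalization.map (Localization (Submonoid.powers (φ s))) φ (powers_le_comap φ s) x.val := by
  obtain ⟨x, rfl⟩ := mk_surjective x
  rw [val_mk, Localization.mk_eq_mk', IsLocalization.map_mk', ← Localization.mk_eq_mk']
  rfl

variable [AddSubgroupClass α A] [AddSubgroupClass β B] [GradedRing 𝒜] [GradedRing ℬ]

/-- If `φ : A → B` sends `𝒜 n` into `ℬ (d * n)`, then `a / sⁿ ↦ φ a / (φ s)ⁿ` defines a ring
homomorphism between the degree zero parts of `A[1/s]` and `B[1/φ s]`. -/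
def awayMapMul {d : ℕ} (φ : A →+* B) (hφ : ∀ n, ∀ a ∈ 𝒜 n, φ a ∈ ℬ (d * n)) (s : A) :
    Away 𝒜 s →+* Away ℬ (φ s) where
  toFun := awayMapMulFun φ hφ s
  map_add' x y := by
    apply val_injective
    simp only [val_awayMapMulFun, val_add, map_add]
  map_mul' x y := by
    apply val_injective
    simp only [val_awayMapMulFun, val_mul, map_mul]
  map_zero' := by
    apply val_injective
    simp only [val_awayMapMulFun, val_zero, map_zero]
  map_one' := by
    apply val_injective
    simp only [val_awayMapMulFun, val_one, map_one]

lemma val_awayMapMul {d : ℕ} (φ : A →+* B) (hφ : ∀ n, ∀ a ∈ 𝒜 n, φ a ∈ ℬ (d * n)) (s : A)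
    (x : Away 𝒜 s) :
    (awayMapMul φ hφ s x).val =
      IsLocalization.map (Localization (Submonoid.powers (φ s))) φ (powers_le_comap φ s) x.val :=
  val_awayMapMulFun φ hφ s x

lemma awayMapMul_mk {d : ℕ} (φ : A →+* B) (hφ : ∀ n, ∀ a ∈ 𝒜 n, φ a ∈ ℬ (d * n)) {m : ℕ}
    (s : A) (hs : s ∈ 𝒜 m) (n : ℕ) (a : A) (ha : a ∈ 𝒜 (n • m)) :
    awayMapMul φ hφ s (Away.mk 𝒜 hs n a ha) =
      Away.mk ℬ (hφ _ _ hs) n (φ a) (by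
        have := hφ _ _ ha; rwa [smul_eq_mul, mul_left_comm] at this) := by
  ext
  rw [val_awayMapMul, Away.val_mk, Away.val_mk, Localization.mk_eq_mk', IsLocalization.map_mk',
    Localization.mk_eq_mk']
  congr 1
  ext
  simp

/-- The homogeneous elements of positive degree. -/
abbrev PosHomogeneous (𝒜 : ℕ → α) : Type _ := Σ n : ℕ+, 𝒜 n

/-- The local pieces `D₊(φ s) = Spec B[1/φ s]₀ ⟶ Spec A[1/s]₀ = D₊(s) ⊆ Proj A`. -/
def projMapMulLocal {d : ℕ} (φ : A →+* B) (hφ : ∀ n, ∀ a ∈ 𝒜 n, φ a ∈ ℬ (d * n))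
    {m : ℕ} (hm : 0 < m) {s : A} (hs : s ∈ 𝒜 m) :
    Spec (.of (Away ℬ (φ s))) ⟶ Proj 𝒜 :=
  Spec.map (CommRingCat.ofHom (awayMapMul φ hφ s)) ≫ Proj.awayι 𝒜 s hs hm

/-- The affine open sets `D₊(φ s)` form a cover of `Proj B` as soon as no point of `Proj B`
contains all of their equations. -/
def projMapMulCover {d : ℕ} (hd : 0 < d) (φ : A →+* B)
    (hφ : ∀ n, ∀ a ∈ 𝒜 n, φ a ∈ ℬ (d * n))
    (hcov : ∀ P : ProjectiveSpectrum ℬ, ∃ s : PosHomogeneous 𝒜, φ s.2 ∉ P.asHomogeneousIdeal) :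
    (Proj ℬ).AffineOpenCover where
  I₀ := PosHomogeneous 𝒜
  X s := .of (Away ℬ (φ s.2))
  f s := Proj.awayι ℬ (φ s.2) (hφ _ _ s.2.2) (Nat.mul_pos hd s.1.2)
  idx x := (hcov x).choose
  covers x := by
    change x ∈ (Proj.awayι ℬ _ _ _).opensRange
    rw [Proj.opensRange_awayι]
    exact (hcov x).choose_spec

lemma awayMapMul_comp_awayMap {d : ℕ} (φ : A →+* B) (hφ : ∀ n, ∀ a ∈ 𝒜 n, φ a ∈ ℬ (d * n))
    {n : ℕ} {s t x : A} (ht : t ∈ 𝒜 n) (hx : x = s * t) (hx' : φ x = φ s * φ t) :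
    (awayMapMul φ hφ x).comp (awayMap 𝒜 ht hx) =
      (awayMap ℬ (hφ _ _ ht) hx').comp (awayMapMul φ hφ s) := by
  apply RingHom.ext
  intro a
  apply val_injective
  rw [RingHom.comp_apply, RingHom.comp_apply, val_awayMapMul, val_awayMap, val_awayMap,
    val_awayMapMul, ← RingHom.comp_apply, ← RingHom.comp_apply]
  congr 1
  apply IsLocalization.ringHom_ext (Submonoid.powers s)
  ext b
  simp [Localization.awayLift, IsLocalization.Away.lift]

lemma projMapMulLocal_compat {d : ℕ} (φ : A →+* B) (hφ : ∀ n, ∀ a ∈ 𝒜 n, φ a ∈ ℬ (d * n))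
    {m n : ℕ} (hm : 0 < m) (hn : 0 < n) {s t : A} (hs : s ∈ 𝒜 m) (ht : t ∈ 𝒜 n)
    (h : φ (s * t) = φ s * φ t) (h' : φ (s * t) = φ t * φ s) :
    Spec.map (CommRingCat.ofHom (awayMap ℬ (hφ _ _ ht) h)) ≫ projMapMulLocal φ hφ hm hs =
      Spec.map (CommRingCat.ofHom (awayMap ℬ (hφ _ _ hs) h')) ≫ projMapMulLocal φ hφ hn ht := by
  rw [projMapMulLocal, projMapMulLocal, ← Category.assoc, ← Category.assoc, ← Spec.map_comp,
    ← Spec.map_comp, ← CommRingCat.ofHom_comp, ← CommRingCat.ofHom_comp,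
    ← awayMapMul_comp_awayMap φ hφ ht rfl h,
    ← awayMapMul_comp_awayMap φ hφ hs (mul_comm _ _) h',
    CommRingCat.ofHom_comp, CommRingCat.ofHom_comp, Spec.map_comp, Spec.map_comp,
    Category.assoc, Category.assoc, Proj.SpecMap_awayMap_awayι, Proj.SpecMap_awayMap_awayι]
  rfl

/-- Let `φ : A → B` be a ring homomorphism with `φ (𝒜 n) ⊆ ℬ (d * n)` for a fixed `d > 0`, such
that no point of `Proj B` contains the image of the irrelevant ideal of `A`. The induced morphism
`Proj B ⟶ Proj A`, glued from `D₊(φ s) ⟶ D₊(s)`. -/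
def projMapMul {d : ℕ} (hd : 0 < d) (φ : A →+* B)
    (hφ : ∀ n, ∀ a ∈ 𝒜 n, φ a ∈ ℬ (d * n))
    (hcov : ∀ P : ProjectiveSpectrum ℬ, ∃ s : PosHomogeneous 𝒜, φ s.2 ∉ P.asHomogeneousIdeal) :
    Proj ℬ ⟶ Proj 𝒜 :=
  (projMapMulCover hd φ hφ hcov).openCover.glueMorphisms
    (fun s ↦ projMapMulLocal φ hφ s.1.2 s.2.2) <| by
    rintro ⟨m, s⟩ ⟨n, t⟩
    have hx' : φ ((s : A) * t) = φ s * φ t := map_mul ..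
    refine (cancel_epi (Proj.pullbackAwayιIso ℬ (hφ _ _ s.2) (Nat.mul_pos hd m.2)
      (hφ _ _ t.2) (Nat.mul_pos hd n.2) hx').inv).mp ?_
    have e1 := Proj.pullbackAwayιIso_inv_fst_assoc ℬ (hφ _ _ s.2) (Nat.mul_pos hd m.2)
      (hφ _ _ t.2) (Nat.mul_pos hd n.2) hx' (projMapMulLocal φ hφ m.2 s.2)
    have e2 := Proj.pullbackAwayιIso_inv_snd_assoc ℬ (hφ _ _ s.2) (Nat.mul_pos hd m.2)
      (hφ _ _ t.2) (Nat.mul_pos hd n.2) hx' (projMapMulLocal φ hφ n.2 t.2)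
    exact e1.trans ((projMapMulLocal_compat φ hφ m.2 n.2 s.2 t.2 hx' _).trans e2.symm)

lemma awayι_projMapMul {d : ℕ} (hd : 0 < d) (φ : A →+* B)
    (hφ : ∀ n, ∀ a ∈ 𝒜 n, φ a ∈ ℬ (d * n))
    (hcov : ∀ P : ProjectiveSpectrum ℬ, ∃ s : PosHomogeneous 𝒜, φ s.2 ∉ P.asHomogeneousIdeal)
    {m : ℕ} (hm : 0 < m) (s : A) (hs : s ∈ 𝒜 m) :
    Proj.awayι ℬ (φ s) (hφ _ _ hs) (Nat.mul_pos hd hm) ≫ projMapMul hd φ hφ hcov =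
      Spec.map (CommRingCat.ofHom (awayMapMul φ hφ s)) ≫ Proj.awayι 𝒜 s hs hm :=
  (projMapMulCover hd φ hφ hcov).openCover.ι_glueMorphisms _ _
    (⟨⟨m, hm⟩, ⟨s, hs⟩⟩ : PosHomogeneous 𝒜)

end ProjMap

/-! ### Weighted projective spaces and pairs -/

section Spaces

variable (k : Type u) [Field k]

instance weightedGrading {n : ℕ} (w : Fin n → ℕ) :
    GradedAlgebra (weightedHomogeneousSubmodule k w) :=
  weightedGradedAlgebra k w

/-- The weighted projective space `ℙ(w₀, …, wₙ₋₁)` over `k`: the scheme `Proj k[x₀, …, xₙ₋₁]`,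
where `xᵢ` has degree `wᵢ`. -/
abbrev WProj {n : ℕ} (w : Fin n → ℕ) : Scheme.{u} :=
  Proj (weightedHomogeneousSubmodule k w)

/-- The structure morphism `ℙ(w₀, …, wₙ₋₁) ⟶ Spec k`. -/
def WProj.toSpec {n : ℕ} (w : Fin n → ℕ) : WProj k w ⟶ Spec (.of k) :=
  Proj.toSpecZero (weightedHomogeneousSubmodule k w) ≫
    Spec.map (CommRingCat.ofHom (algebraMap k (weightedHomogeneousSubmodule k w 0)))

/-- The closed subset `F = 0` of `ℙ(w₀, …, wₙ₋₁)`. -/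
def WProj.zeros {n : ℕ} (w : Fin n → ℕ) (F : MvPolynomial (Fin n) k) :
    TopologicalSpace.Closeds (WProj k w) :=
  ⟨ProjectiveSpectrum.zeroLocus _ {F}, ProjectiveSpectrum.isClosed_zeroLocus _ _⟩

/-- A pair over `k`: a `k`-scheme together with a closed subset, the boundary. The boundary
carries the reduced induced scheme structure, see `Pair.boundaryIdeal`. -/
structure Pair where
  /-- the underlying scheme -/
  space : Scheme.{u}
  /-- its structure morphism -/
  toSpec : space ⟶ Spec (.of k)
  /-- the support of the boundary -/
  boundary : TopologicalSpace.Closeds space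

variable {k}

/-- The ideal sheaf of the reduced boundary. -/
def Pair.boundaryIdeal (W : Pair k) : W.space.IdealSheafData :=
  Scheme.IdealSheafData.vanishingIdeal W.boundary

variable (k) in
/-- The pair `ℙ¹_∞ = (ℙ¹, ∞)`, with `∞ = [1 : 0]` the point where the second coordinate
vanishes. -/
def P1Infty : Pair k where
  space := WProj k ![1, 1]
  toSpec := WProj.toSpec k ![1, 1]
  boundary := WProj.zeros k ![1, 1] (X 1)

/-- An `𝔸¹`-curve in a pair `W`: a morphism `f : ℙ¹ ⟶ W` over `k` such that the preimage of the
boundary of `W` is exactly the point `∞`. Such an `f` is automatically non-constant, and when `W`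
is proper these are exactly the extensions to `ℙ¹` of the non-constant proper morphisms from `𝔸¹`
to the complement of the boundary of `W`. -/
structure A1Curve (W : Pair k) where
  /-- the underlying morphism -/
  hom : (P1Infty k).space ⟶ W.space
  /-- it is a morphism over `k` -/
  hom_toSpec : hom ≫ W.toSpec = (P1Infty k).toSpec
  /-- the preimage of the boundary is `∞` -/
  preimage_boundary : hom ⁻¹' (W.boundary : Set W.space) = (P1Infty k).boundary

/-- The divisor `f^* Δ_W` on `ℙ¹`: the scheme theoretic preimage of the reduced boundary of `W`. -/
def A1Curve.pullbackBoundary {W : Pair k} (f : A1Curve W) : Scheme.{u} :=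
  (W.boundaryIdeal.comap f.hom).subscheme

/-- The `k`-algebra structure on the global functions of `f^* Δ_W`. -/
def A1Curve.scalarMap {W : Pair k} (f : A1Curve W) :
    k →+* Γ(f.pullbackBoundary, ⊤) :=
  (((W.boundaryIdeal.comap f.hom).subschemeι ≫ (P1Infty k).toSpec).appTop.hom).comp
    (Scheme.ΓSpecIso (.of k)).inv.hom

/-- The contact order of `f` at `∞`: the degree of the divisor `f^* Δ_W` of `ℙ¹`, that is, the
dimension over `k` of its ring of functions. -/
def A1Curve.contactOrder {W : Pair k} (f : A1Curve W) : ℕ :=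
  letI : Algebra k Γ(f.pullbackBoundary, ⊤) := f.scalarMap.toAlgebra
  Module.finrank k Γ(f.pullbackBoundary, ⊤)

end Spaces

/-! ### The pairs `X` and `Z` and the morphism between them -/

section XZ

variable {k : Type u} [Field k]

/-- The form `∑_{i = 1}^{p - 1} cᵢ x₀ⁱ x₁^{p - i}` in three variables `x₀, x₁, x₂`. -/
def sigma (p : ℕ) (c : ℕ → k) : MvPolynomial (Fin 3) k :=
  ∑ i ∈ Finset.Icc 1 (p - 1), C (c i) * X 0 ^ i * X 1 ^ (p - i)

/-- The pair `X = (ℙ², Δ_X)` with `Δ_X = (σ(x₀, x₁) - x₂ᵖ = 0)`, where `σ` has coefficients `c`. -/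
def pairX (p : ℕ) (c : ℕ → k) : Pair k where
  space := WProj k ![1, 1, 1]
  toSpec := WProj.toSpec k ![1, 1, 1]
  boundary := WProj.zeros k ![1, 1, 1] (sigma p c - X 2 ^ p)

variable (k) in
/-- The pair `Z = (ℙ(1, 1, p), Δ_Z)` with `Δ_Z = (z₂ = 0)`. -/
def pairZ (p : ℕ) : Pair k where
  space := WProj k ![1, 1, p]
  toSpec := WProj.toSpec k ![1, 1, p]
  boundary := WProj.zeros k ![1, 1, p] (X 2)

lemma sigma_isWeightedHomogeneous (p : ℕ) (c : ℕ → k) :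
    IsWeightedHomogeneous ![1, 1, p] (sigma p c) p := by
  refine IsWeightedHomogeneous.sum _ _ _ fun i hi ↦ ?_
  have h := (((isWeightedHomogeneous_X k ![1, 1, p] (0 : Fin 3)).pow i).C_mul (c i)).mul
    ((isWeightedHomogeneous_X k ![1, 1, p] (1 : Fin 3)).pow (p - i))
  have hi' := Finset.mem_Icc.mp hi
  convert h using 1
  simp
  omega

variable (p : ℕ) [Fact p.Prime] [CharP k p] [PerfectRing k p]

/-- The form `σ^{1/p}`, whose coefficients are the `p`-th roots of the coefficients of `σ`. -/
def sigmaRoot (c : ℕ → k) : MvPolynomial (Fin 3) k :=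
  sigma p fun i ↦ (frobeniusEquiv k p).symm (c i)

/-- The substitution `x₀ ↦ z₀ᵖ, x₁ ↦ z₁ᵖ, x₂ ↦ σ^{1/p}(z₀, z₁) - z₂`. -/
def substZX (c : ℕ → k) : MvPolynomial (Fin 3) k →ₐ[k] MvPolynomial (Fin 3) k :=
  aeval ![X 0 ^ p, X 1 ^ p, sigmaRoot p c - X 2]

lemma substZX_mem (c : ℕ → k) (n : ℕ) (F : MvPolynomial (Fin 3) k)
    (hF : F ∈ weightedHomogeneousSubmodule k ![1, 1, 1] n) :
    (substZX p c : _ →+* _) F ∈ weightedHomogeneousSubmodule k ![1, 1, p] (p * n) := by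
  have hX : ∀ i : Fin 3, IsWeightedHomogeneous ![1, 1, p]
      ((![X 0 ^ p, X 1 ^ p, sigmaRoot p c - X 2] : Fin 3 → MvPolynomial (Fin 3) k) i) p := by
    intro i
    fin_cases i
    · simpa using (isWeightedHomogeneous_X k ![1, 1, p] (0 : Fin 3)).pow p
    · simpa using (isWeightedHomogeneous_X k ![1, 1, p] (1 : Fin 3)).pow p
    · exact (sigma_isWeightedHomogeneous p _).sub
        (isWeightedHomogeneous_X k ![1, 1, p] (2 : Fin 3))
  have hsum : (substZX p c : _ →+* _) F = ∑ d ∈ F.support, C (F.coeff d) * ∏ i : Fin 3,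
      ((![X 0 ^ p, X 1 ^ p, sigmaRoot p c - X 2] : Fin 3 → MvPolynomial (Fin 3) k) i) ^ d i := by
    change aeval _ F = _
    rw [aeval_def, eval₂_eq']
    rfl
  rw [hsum]
  refine IsWeightedHomogeneous.sum _ _ _ fun d hd ↦ IsWeightedHomogeneous.C_mul ?_ _
  have h := IsWeightedHomogeneous.prod Finset.univ _ (fun i : Fin 3 ↦ d i • p)
    fun i _ ↦ (hX i).pow (d i)
  convert h using 1
  have hn := hF (mem_support_iff.mp hd)
  rw [Finsupp.weight_apply, Finsupp.sum_fintype _ _ (by simp)] at hn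
  rw [← hn, Finset.mul_sum]
  refine Finset.sum_congr rfl fun i _ ↦ ?_
  fin_cases i <;> simp [mul_comm]

lemma substZX_cover (c : ℕ → k)
    (P : ProjectiveSpectrum (weightedHomogeneousSubmodule k ![1, 1, p])) :
    ∃ s : PosHomogeneous (weightedHomogeneousSubmodule k ![1, 1, 1]),
      (substZX p c : _ →+* _) (s.2 : MvPolynomial (Fin 3) k) ∉ P.asHomogeneousIdeal := by
  by_contra! H
  have hp : p.Prime := Fact.out
  have hP : P.asHomogeneousIdeal.toIdeal.IsPrime := P.isPrime
  have hx : ∀ i : Fin 3, (![X 0 ^ p, X 1 ^ p, sigmaRoot p c - X 2] :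
      Fin 3 → MvPolynomial (Fin 3) k) i ∈ P.asHomogeneousIdeal.toIdeal := by
    intro i
    have hmem : (X i : MvPolynomial (Fin 3) k) ∈ weightedHomogeneousSubmodule k ![1, 1, 1] 1 := by
      have := isWeightedHomogeneous_X k ![1, 1, 1] i
      fin_cases i <;> exact this
    have := H ⟨1, ⟨X i, hmem⟩⟩
    change aeval _ (X i) ∈ _ at this
    rw [aeval_X] at this
    exact this
  have h0 : (X 0 : MvPolynomial (Fin 3) k) ∈ P.asHomogeneousIdeal.toIdeal :=
    hP.mem_of_pow_mem p (hx 0)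
  have h1 : (X 1 : MvPolynomial (Fin 3) k) ∈ P.asHomogeneousIdeal.toIdeal :=
    hP.mem_of_pow_mem p (hx 1)
  have hs : sigmaRoot p c ∈ P.asHomogeneousIdeal.toIdeal := by
    rw [sigmaRoot, sigma]
    refine sum_mem fun i hi ↦ ?_
    apply Ideal.mul_mem_right
    apply Ideal.mul_mem_left
    exact Ideal.pow_mem_of_mem _ h0 _ (Finset.mem_Icc.mp hi).1
  have h2 : (X 2 : MvPolynomial (Fin 3) k) ∈ P.asHomogeneousIdeal.toIdeal := by
    have := Ideal.sub_mem _ hs (hx 2)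
    simpa using this
  have hX : ∀ i : Fin 3, (X i : MvPolynomial (Fin 3) k) ∈ P.asHomogeneousIdeal.toIdeal := by
    intro i
    fin_cases i
    exacts [h0, h1, h2]
  refine P.not_irrelevant_le ((HomogeneousIdeal.toIdeal_irrelevant_le _).mpr ?_)
  intro n hn F hF
  rw [F.as_sum]
  refine Ideal.sum_mem _ fun d hd ↦ ?_
  have hdn := hF (mem_support_iff.mp hd)
  obtain ⟨i, hi⟩ : ∃ i, d i ≠ 0 := by
    by_contra! h
    have : d = 0 := Finsupp.ext h
    simp [this] at hdn
    omega
  rw [monomial_eq, Finsupp.prod_fintype _ _ (by simp)]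
  obtain ⟨y, hy⟩ := Finset.dvd_prod_of_mem
    (fun i : Fin 3 ↦ (X i : MvPolynomial (Fin 3) k) ^ d i) (Finset.mem_univ i)
  rw [hy]
  exact Ideal.mul_mem_left _ _
    (Ideal.mul_mem_right _ _ (Ideal.pow_mem_of_mem _ (hX i) _ (Nat.pos_of_ne_zero hi)))

/-- The morphism `F_{Z/X} : Z ⟶ X`,
`[z₀ : z₁ : z₂] ↦ [z₀ᵖ : z₁ᵖ : σ^{1/p}(z₀, z₁) - z₂]`. -/
def mapZX (c : ℕ → k) : (pairZ k p).space ⟶ (pairX p c).space :=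
  projMapMul (Nat.Prime.pos Fact.out : 0 < p) (substZX p c : _ →+* _) (substZX_mem p c)
    (substZX_cover p c)

end XZ

end

end A1Curves

namespace A1Curves

noncomputable section

/-! ### Ideal sheaves in charts -/

section IdealSheaves

open Scheme Scheme.IdealSheafData Limits

/-! Write `q = σ(x₀, x₁) - x₂ᵖ` for the equation of `Δ_X` and `F` for `F_{Z/X}`. Since `σ(z₀ᵖ, z₁ᵖ)
= σ^{1/p}(z₀, z₁)ᵖ`, the substitution defining `F` sends `q` to `z₂ᵖ` (`substZX_boundary`). Moreover
the `p`-th power of every form on `Z` comes from `X` (`exists_substZX_eq_pow`), so `F` is integral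
and purely inseparable.

Existence. As `F` is integral and `ℙ¹` is normal, it is enough to lift the generic point of `ℙ¹`
(`exists_lift_of_isIntegralHom`), that is, to show that the ratio of `x₀` and `x₁` along `f` is a
`p`-th power in `k(t)`; then `z₂` is determined by `x₂` (`exists_point_lift`). Coprime polynomial
coordinates `A, D, B` of `f` on `𝔸¹` satisfy `σ(A, D) - Bᵖ = constant ≠ 0`, because `f` meets `Δ_X`
only over `∞`. Differentiating kills `Bᵖ`, and Euler's relation in characteristic `p` factors the
rest as `T(A, D) (A'D - AD') = 0`. Either `T(A, D) = 0` and `A / D` is a constant, or the Wronskian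
vanishes and `A / D` is a `p`-th power (`exists_pow_eq_of_mul_sub_pow_eq_one`).

Uniqueness. `p`-th roots in the function field are unique, so lifts of the generic point agree
(`mapZX_cancel`); as `ℙ¹` is reduced and `F` separated, so do lifts of `f`.

Contact orders. `q` is prime by Eisenstein, so it generates the reduced ideal of `Δ_X` near `Δ_X`,
and `q ↦ z₂ᵖ` gives `F^* Δ_X = p Δ_Z` (`comap_boundaryIdeal`). Pulling back to `ℙ¹` multiplies
degrees by `p`. -/

lemma comap_pow_of_isOpenImmersion {X Y : Scheme.{u}} (I : Y.IdealSheafData) (f : X ⟶ Y)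
    [IsOpenImmersion f] (n : ℕ) : (I ^ n).comap f = I.comap f ^ n := by
  ext U : 2
  simp only [ideal_pow, Pi.pow_apply, ideal_comap_of_isOpenImmersion]
  let e := (f.appIso U.1).symm.commRingCatIsoToRingEquiv
  change Ideal.comap e _ = Ideal.comap e _ ^ n
  rw [← Ideal.map_symm, ← Ideal.map_symm, Ideal.map_pow]

/-- Ideal sheaves that agree on the members of an open cover are equal. -/
lemma idealSheaf_ext_of_openCover {X : Scheme.{u}} {I J : X.IdealSheafData} (𝒰 : X.OpenCover)
    (h : ∀ i, I.comap (𝒰.f i) = J.comap (𝒰.f i)) : I = J := by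
  suffices H : ∀ (I J : X.IdealSheafData), (∀ i, I.comap (𝒰.f i) = J.comap (𝒰.f i)) → I ≤ J from
    (H I J h).antisymm (H J I fun i ↦ (h i).symm)
  intro I J h
  refine le_of_iSup_eq_top (ι := Σ i, (𝒰.X i).affineOpens)
    (fun i ↦ ⟨𝒰.f i.1 ''ᵁ i.2.1, i.2.2.image_of_isOpenImmersion _⟩) ?_ ?_
  · rw [eq_top_iff]
    intro x _
    obtain ⟨y, hy⟩ := 𝒰.covers x
    obtain ⟨_, ⟨V, hV, rfl⟩, hyV, -⟩ :=
      (𝒰.X (𝒰.idx x)).isBasis_affineOpens.exists_subset_of_mem_open (Set.mem_univ y) isOpen_univ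
    exact TopologicalSpace.Opens.mem_iSup.mpr ⟨⟨𝒰.idx x, ⟨V, hV⟩⟩, ⟨y, hyV, hy⟩⟩
  · rintro ⟨i, U⟩
    have e := congr(($(h i)).ideal U)
    rw [ideal_comap_of_isOpenImmersion, ideal_comap_of_isOpenImmersion] at e
    exact (Ideal.comap_injective_of_surjective _
      ((𝒰.f i).appIso U.1).symm.commRingCatIsoToRingEquiv.surjective e).le

/-- The ideal of `R` corresponding to an ideal sheaf on `Spec R`. -/
def specIdeal {R : CommRingCat.{u}} (I : (Spec R).IdealSheafData) : Ideal R :=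
  (I.ideal ⟨⊤, isAffineOpen_top _⟩).comap (Scheme.ΓSpecIso R).inv.hom

lemma specIdeal_le_iff {R : CommRingCat.{u}} {I J : (Spec R).IdealSheafData} :
    specIdeal I ≤ specIdeal J ↔ I ≤ J := by
  let e := (Scheme.ΓSpecIso R).symm.commRingCatIsoToRingEquiv
  refine ⟨fun h ↦ le_of_isAffine ?_, fun h ↦ Ideal.comap_mono (h _)⟩
  intro x hx
  obtain ⟨y, rfl⟩ := e.surjective x
  exact h hx

lemma specIdeal_injective {R : CommRingCat.{u}} :
    Function.Injective (specIdeal (R := R)) := fun _ _ h ↦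
  (specIdeal_le_iff.mp h.le).antisymm (specIdeal_le_iff.mp h.ge)

lemma specIdeal_surjective {R : CommRingCat.{u}} :
    Function.Surjective (specIdeal (R := R)) := by
  intro I
  let e := (Scheme.ΓSpecIso R).symm.commRingCatIsoToRingEquiv
  refine ⟨equivOfIsAffine.symm (I.comap e.symm), ?_⟩
  have : (equivOfIsAffine.symm (I.comap (e.symm : _ →+* _)) : (Spec R).IdealSheafData).ideal
      ⟨⊤, isAffineOpen_top _⟩ = I.comap (e.symm : _ →+* _) := equivOfIsAffine.apply_symm_apply _
  rw [specIdeal]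
  refine (congrArg _ this).trans ?_
  ext x
  simp only [Ideal.mem_comap]
  change e.symm (e x) ∈ I ↔ _
  simp

lemma specIdeal_pow {R : CommRingCat.{u}} (I : (Spec R).IdealSheafData) (n : ℕ) :
    specIdeal (I ^ n) = specIdeal I ^ n := by
  let e := (Scheme.ΓSpecIso R).symm.commRingCatIsoToRingEquiv
  change Ideal.comap e _ = Ideal.comap e _ ^ n
  rw [← Ideal.map_symm, ← Ideal.map_symm, ideal_pow, Pi.pow_apply, Ideal.map_pow]

lemma specIdeal_map {R S : CommRingCat.{u}} (φ : R ⟶ S) (I : (Spec S).IdealSheafData) :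
    specIdeal (I.map (Spec.map φ)) = (specIdeal I).comap φ.hom := by
  have h := ideal_map_of_isAffineHom I (Spec.map φ) ⟨⊤, isAffineOpen_top _⟩
  rw [specIdeal, h, specIdeal, Ideal.comap_comap, Ideal.comap_comap, ← CommRingCat.hom_comp,
    ← CommRingCat.hom_comp]
  have := Scheme.ΓSpecIso_inv_naturality φ
  rw [this]
  rfl

/-- By uniqueness of left adjoints: pullback is left adjoint to pushforward of ideal sheaves,
extension is left adjoint to contraction of ideals, and `specIdeal_map` matches the right adjoints.
-/
lemma specIdeal_comap {R S : CommRingCat.{u}} (φ : R ⟶ S) (I : (Spec R).IdealSheafData) :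
    specIdeal (I.comap (Spec.map φ)) = (specIdeal I).map φ.hom := by
  refine eq_of_forall_ge_iff fun J ↦ ?_
  obtain ⟨J, rfl⟩ := specIdeal_surjective J
  rw [specIdeal_le_iff, ← le_map_iff_comap_le, ← specIdeal_le_iff, specIdeal_map,
    Ideal.map_le_iff_le_comap]

/-- Every morphism is covered by morphisms of affine schemes. -/
lemma exists_affine_charts {X Y : Scheme.{u}} (f : X ⟶ Y) (x : X) :
    ∃ (R S : CommRingCat.{u}) (j : Spec S ⟶ X) (i : Spec R ⟶ Y) (φ : R ⟶ S),
      IsOpenImmersion j ∧ IsOpenImmersion i ∧ j ≫ f = Spec.map φ ≫ i ∧ x ∈ Set.range j := by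
  obtain ⟨_, ⟨V, hV, rfl⟩, hxV, -⟩ :=
    Y.isBasis_affineOpens.exists_subset_of_mem_open (Set.mem_univ (f x)) isOpen_univ
  obtain ⟨_, ⟨U, hU, rfl⟩, hxU, hUV⟩ :=
    X.isBasis_affineOpens.exists_subset_of_mem_open (u := (f ⁻¹ᵁ V : Set X)) hxV (f ⁻¹ᵁ V).2
  exact ⟨_, _, hU.fromSpec, hV.fromSpec, f.appLE V U hUV, hU.isOpenImmersion_fromSpec,
    hV.isOpenImmersion_fromSpec, (hV.SpecMap_appLE_fromSpec f hU hUV).symm,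
    by rwa [hU.range_fromSpec]⟩

/-- The case of open immersions reduces this to affine charts, where it is `Ideal.map_pow`. It
carries the multiplicity `p` of `F^* Δ_X` back to `ℙ¹`. -/
lemma comap_pow {X Y : Scheme.{u}} (I : Y.IdealSheafData) (f : X ⟶ Y) (n : ℕ) :
    (I ^ n).comap f = I.comap f ^ n := by
  choose R S j i φ hj hi e hx using fun x ↦ exists_affine_charts f x
  let 𝒰 : X.OpenCover :=
    { I₀ := X
      X x := Spec (S x)
      f := j
      mem₀ := by
        rw [presieve₀_mem_precoverage_iff]
        exact ⟨fun x ↦ ⟨x, hx x⟩, hj⟩ }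
  refine idealSheaf_ext_of_openCover 𝒰 fun x ↦ ?_
  have := hj x
  have := hi x
  change ((I ^ n).comap f).comap (j x) = (I.comap f ^ n).comap (j x)
  rw [comap_pow_of_isOpenImmersion _ (j x), ← comap_comp, ← comap_comp, e x, comap_comp, comap_comp,
    comap_pow_of_isOpenImmersion]
  apply specIdeal_injective
  rw [specIdeal_comap, specIdeal_pow, specIdeal_pow, specIdeal_comap, Ideal.map_pow]

lemma mem_specIdeal_comap_vanishingIdeal {X : Scheme.{u}} {R : CommRingCat.{u}} (i : Spec R ⟶ X)
    [IsOpenImmersion i] (Z : TopologicalSpace.Closeds X) (r : R) :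
    r ∈ specIdeal ((vanishingIdeal Z).comap i) ↔
      ∀ x : Spec R, i x ∈ Z → r ∈ PrimeSpectrum.asIdeal x := by
  have hV : IsAffineOpen (i ''ᵁ ⊤) := (isAffineOpen_top _).image_of_isOpenImmersion i
  let φ : Γ(X, i ''ᵁ ⊤) ≅ R := i.appIso ⊤ ≪≫ Scheme.ΓSpecIso R
  -- This triangle and its inverse `hφ'` move points between `Spec R` and the affine open image of
  -- `i`, where `vanishingIdeal` is computed.
  have hφ : Spec.map φ.hom ≫ hV.fromSpec = i := by
    have := hV.SpecMap_appLE_fromSpec i (isAffineOpen_top _) (by simp)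
    rw [IsAffineOpen.fromSpec_top, Scheme.isoSpec_Spec_inv, ← Scheme.Hom.appIso_hom'] at this
    simp only [φ, Iso.trans_hom, Spec.map_comp, Category.assoc]
    refine (congrArg (Spec.map (Scheme.ΓSpecIso R).hom ≫ ·) ?_).trans
      ((congrArg (Spec.map (Scheme.ΓSpecIso R).hom ≫ ·) this).trans ?_)
    · rfl
    · simp
  have hφ' : Spec.map φ.inv ≫ i = hV.fromSpec := by
    refine (congrArg (Spec.map φ.inv ≫ ·) hφ.symm).trans ?_
    rw [← Category.assoc, ← Spec.map_comp, Iso.hom_inv_id, Spec.map_id, Category.id_comp]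
  rw [specIdeal, ideal_comap_of_isOpenImmersion, vanishingIdeal_ideal, Ideal.mem_comap,
    Ideal.mem_comap, PrimeSpectrum.mem_vanishingIdeal]
  constructor
  · intro h x hx
    have h2 : φ.hom (φ.inv r) ∈ PrimeSpectrum.asIdeal x := h (Spec.map φ.hom x) (by
      change (Spec.map φ.hom ≫ hV.fromSpec) x ∈ Z
      rwa [hφ])
    simpa using h2
  · intro h p hp
    refine h (Spec.map φ.inv p) ?_
    change (Spec.map φ.inv ≫ i) p ∈ Z
    rw [hφ']
    exact hp

/-- The ring of functions of a closed subscheme contained in an affine chart. -/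
lemma exists_subscheme_sections {X : Scheme.{u}} {R : CommRingCat.{u}} (j : Spec R ⟶ X)
    [IsOpenImmersion j] (J : X.IdealSheafData) (hJ : (J.support : Set X) ⊆ Set.range j) :
    ∃ q : R →+* Γ(J.subscheme, ⊤), Function.Surjective q ∧
      RingHom.ker q = specIdeal (J.comap j) ∧
      ∀ r : Γ(X, ⊤), q ((Scheme.ΓSpecIso R).hom.hom (j.appTop.hom r)) =
        J.subschemeι.appTop.hom r := by
  let i := (J.comap j).subschemeι
  let m := (J.comapIso j).hom ≫ pullback.snd j J.subschemeι
  have hm : m ≫ J.subschemeι = i ≫ j := by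
    simp only [m, Category.assoc, ← pullback.condition, comapIso_hom_fst_assoc, i]
  -- The support lies in the chart, so the base change of `j` to the subscheme is a surjective open
  -- immersion, hence an isomorphism.
  have : Surjective (pullback.snd j J.subschemeι) := by
    refine ⟨Set.range_eq_univ.mp ?_⟩
    rw [IsOpenImmersion.range_pullbackSnd]
    refine Set.eq_univ_of_forall fun x ↦ hJ ?_
    rw [← range_subschemeι]
    exact ⟨x, rfl⟩
  have : IsIso (pullback.snd j J.subschemeι) :=
    (isIso_iff_isOpenImmersion_and_surjective _).mpr ⟨inferInstance, inferInstance⟩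
  have : IsIso m := inferInstance
  have hs : Function.Surjective i.appTop.hom :=
    (J.comap j).subschemeι_app_surjective ⟨⊤, isAffineOpen_top _⟩
  have hk : RingHom.ker i.appTop.hom = (J.comap j).ideal ⟨⊤, isAffineOpen_top _⟩ :=
    (J.comap j).ker_subschemeι_app ⟨⊤, isAffineOpen_top _⟩
  have : IsIso m.appTop := inferInstanceAs (IsIso (m.app ⊤))
  let e := (asIso m.appTop).symm.commRingCatIsoToRingEquiv
  let e' := (Scheme.ΓSpecIso R).symm.commRingCatIsoToRingEquiv
  refine ⟨(e : _ →+* _).comp (i.appTop.hom.comp (e' : _ →+* _)),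
    e.surjective.comp (hs.comp e'.surjective), ?_, fun r ↦ ?_⟩
  · refine Eq.trans (b := RingHom.ker (i.appTop.hom.comp (e' : _ →+* _))) ?_ ?_
    · ext x
      exact map_eq_zero_iff e e.injective
    · rw [← RingHom.comap_ker, hk]
      rfl
  · have h1 := congr(($hm).appTop.hom r)
    have h2 : e' ((Scheme.ΓSpecIso R).hom.hom (j.appTop.hom r)) = j.appTop.hom r := by
      change (Scheme.ΓSpecIso R).inv _ = _
      simp
    simp only [RingHom.comp_apply, RingHom.coe_coe]
    rw [h2]
    apply e.symm.injective
    rw [RingEquiv.symm_apply_apply]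
    simp only [Scheme.Hom.comp_appTop, CommRingCat.hom_comp, RingHom.comp_apply] at h1
    exact h1.symm

end IdealSheaves

/-! ### Extending generic lifts over a normal integral scheme -/

section Normalization

open Scheme

variable (P : Scheme.{u}) [IsIntegral P]

instance isDominant_fromSpecStalk_genericPoint :
    IsDominant (P.fromSpecStalk (genericPoint P)) := by
  refine ⟨?_⟩
  have : Dense {genericPoint P} := by
    rw [dense_iff_closure_eq]; exact genericPoint_spec P
  refine this.mono ?_
  rintro _ rfl
  exact ⟨_, Scheme.fromSpecStalk_closedPoint⟩

instance quasiCompact_fromSpecStalk_genericPoint :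
    QuasiCompact (P.fromSpecStalk (genericPoint P)) := by
  have : Subsingleton (Spec P.functionField) :=
    inferInstanceAs (Subsingleton (PrimeSpectrum P.functionField))
  exact ⟨fun U _ _ ↦ Set.subsingleton_of_subsingleton.isCompact⟩

instance quasiSeparated_fromSpecStalk_genericPoint :
    QuasiSeparated (P.fromSpecStalk (genericPoint P)) := inferInstance

/-- Stated for a ring `A` only isomorphic to the fraction field, because the sections that occur in
the normalization are those over the preimage of an open set in `Spec K`. -/
lemma bijective_algebraMap_integralClosure {R A K : Type*} [CommRing R] [CommRing A] [Field K]
    [IsDomain R] [IsIntegrallyClosed R] [Algebra R K] [IsFractionRing R K] [Algebra R A]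
    (e : A ≃+* K) (he : ∀ r, e (algebraMap R A r) = algebraMap R K r) :
    Function.Bijective (algebraMap R (integralClosure R A)) := by
  constructor
  · intro a b hab
    apply IsFractionRing.injective R K
    rw [← he, ← he]
    exact congrArg (fun x : integralClosure R A ↦ e x) hab
  · rintro ⟨a, ha⟩
    let e' : A →ₐ[R] K := { (e : A →+* K) with commutes' := he }
    obtain ⟨r, hr⟩ := IsIntegrallyClosed.isIntegral_iff.mp (IsIntegral.map e' ha)
    exact ⟨r, Subtype.ext (e.injective ((he r).trans hr))⟩

/-- An integral scheme covered by spectra of integrally closed domains is normal in its function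
field. -/
lemma isIso_fromNormalization_of_isIntegrallyClosed
    {ι : Type*} (U : ι → P.affineOpens)
    (hU : ⨆ i, (U i).1 = ⊤) (hne : ∀ i, Nonempty (U i).1)
    (h : ∀ i, IsIntegrallyClosed Γ(P, (U i).1)) :
    IsIso (P.fromSpecStalk (genericPoint P)).fromNormalization := by
  rw [← MorphismProperty.isomorphisms.iff]
  refine (IsZariskiLocalAtTarget.iff_of_iSup_eq_top (P := MorphismProperty.isomorphisms Scheme)
    (fun i ↦ (U i).1) hU).mpr ?_
  intro i
  have hUi : IsAffineOpen (U i).1 := (U i).2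
  have := hne i
  have := h i
  have := functionField_isFractionRing_of_isAffineOpen P (U i).1 hUi
  have hη : genericPoint P ∈ (U i).1 := 
    ((genericPoint_spec P).mem_open_set_iff (U i).1.isOpen).mpr (by simpa using hne i)
  let η := P.fromSpecStalk (genericPoint P)
  have htop : η ⁻¹ᵁ (U i).1 = ⊤ := by
    have : Subsingleton (Spec P.functionField) :=
      inferInstanceAs (Subsingleton (PrimeSpectrum P.functionField))
    rw [eq_top_iff]
    intro x _
    rw [Subsingleton.elim x (IsLocalRing.closedPoint (P.presheaf.stalk (genericPoint P)))]
    change η _ ∈ (U i).1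
    rw [Scheme.fromSpecStalk_closedPoint]
    exact hη
  let e : Γ(Spec P.functionField, η ⁻¹ᵁ (U i).1) ≅ P.functionField :=
    (Spec P.functionField).presheaf.mapIso (eqToIso htop.symm).op ≪≫ Scheme.ΓSpecIso _
  have he : η.app (U i).1 ≫ e.hom = P.presheaf.germ _ _ hη := by
    rw [Scheme.fromSpecStalk_app hη]
    simp [e, ← Functor.map_comp_assoc]
  refine (isIso_morphismRestrict_iff_isIso_app η.fromNormalization hUi).mpr ?_
  rw [Scheme.Hom.fromNormalization_app η hUi]
  let := (η.app (U i).1).hom.toAlgebra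
  have hb := bijective_algebraMap_integralClosure (R := Γ(P, (U i).1)) (K := P.functionField)
    e.commRingCatIsoToRingEquiv (fun r ↦ congr(($he).hom r))
  have : IsIso (CommRingCat.ofHom (algebraMap Γ(P, (U i).1)
      (integralClosure Γ(P, (U i).1) Γ(Spec P.functionField, η ⁻¹ᵁ (U i).1)))) :=
    (ConcreteCategory.isIso_iff_bijective _).mpr hb
  exact IsIso.comp_isIso

/-- A morphism from a normal scheme lifts along an integral morphism as soon as it does so
generically. -/
lemma exists_lift_of_isIntegralHom {X Z : Scheme.{u}}
    {ι : Type*} (U : ι → P.affineOpens)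
    (hU : ⨆ i, (U i).1 = ⊤) (hne : ∀ i, Nonempty (U i).1)
    (h : ∀ i, IsIntegrallyClosed Γ(P, (U i).1)) (F : Z ⟶ X) [IsIntegralHom F] (f : P ⟶ X)
    (z : Spec P.functionField ⟶ Z) (hz : z ≫ F = P.fromSpecStalk (genericPoint P) ≫ f) :
    ∃ g : P ⟶ Z, g ≫ F = f := by
  have := isIso_fromNormalization_of_isIntegrallyClosed P U hU hne h
  let η := P.fromSpecStalk (genericPoint P)
  -- The pair `(z, η)` is a generic section of the integral morphism `Z ×_X P ⟶ P`. The universal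
  -- property of normalization extends it to the normalization of `P` in its generic point, which is
  -- `P`.
  refine ⟨inv η.fromNormalization ≫ η.normalizationDesc (Limits.pullback.lift z η hz)
    (Limits.pullback.snd F f) (Limits.pullback.lift_snd _ _ _).symm ≫ Limits.pullback.fst F f, ?_⟩
  simp [Limits.pullback.condition, η]

end Normalization

/-! ### A criterion for being a `p`-th power in `k(t)` -/

section PthPower

open Polynomial Finset

variable {k : Type*} [Field k] {p : ℕ}

/-- Euler's relation for a form `S` of degree `p` reads `A S_A + D S_D = pS = 0`, so `S_A = D T` and
`S_D = -A T` with a common factor `T`. On coefficients this is `p - i = -i`. -/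
lemma derivative_sum_homogeneous [CharP k p] (c : ℕ → k) (A D : k[X]) :
    derivative (∑ i ∈ Icc 1 (p - 1), Polynomial.C (c i) * A ^ i * D ^ (p - i)) =
      (∑ i ∈ Icc 1 (p - 1), Polynomial.C (i * c i) * A ^ (i - 1) * D ^ (p - 1 - i)) *
        (derivative A * D - A * derivative D) := by
  rw [map_sum, Finset.sum_mul]
  refine Finset.sum_congr rfl fun i hi ↦ ?_
  obtain ⟨h1, h2⟩ := Finset.mem_Icc.mp hi
  obtain ⟨j, rfl⟩ : ∃ j, i = j + 1 := ⟨i - 1, by omega⟩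
  obtain ⟨m, hm⟩ : ∃ m, p = j + 1 + (m + 1) := ⟨p - (j + 1) - 1, by omega⟩
  have e1 : p - (j + 1) = m + 1 := by omega
  have e2 : p - 1 - (j + 1) = m := by omega
  have e3 : ((m + 1 : ℕ) : k[X]) = - ((j + 1 : ℕ) : k[X]) := by
    have : ((j + 1 + (m + 1) : ℕ) : k[X]) = 0 := by rw [← hm, CharP.cast_eq_zero]
    push_cast at this ⊢
    linear_combination this
  rw [e1, e2]
  simp only [derivative_mul, derivative_C, derivative_pow_succ, Nat.add_sub_cancel, map_mul,
    map_natCast, map_add, map_one, Nat.cast_add, Nat.cast_one]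
  push_cast at e3 ⊢
  linear_combination (Polynomial.C (c (j + 1)) * A ^ (j + 1) * D ^ m * derivative D) * e3

variable [hp : Fact p.Prime] [CharP k p]

lemma exists_pow_eq_of_derivative_eq_zero [PerfectRing k p] {f : k[X]}
    (hf : derivative f = 0) : ∃ h : k[X], h ^ p = f := by
  refine ⟨(contract p f).map (frobeniusEquiv k p).symm, ?_⟩
  rw [← polynomial_expand_eq, expand_contract p hf hp.out.ne_zero]

/-- Coprime polynomial coordinates for the point `[D : A : B] = [1 : a : b]`: take any common
denominator and divide by the gcd `h`. -/
lemma exists_bezout_fractions {K : Type*} [Field K] [Algebra k[X] K] [IsFractionRing k[X] K]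
    (a b : K) : ∃ A B D u v w : k[X], D ≠ 0 ∧ u * A + v * B + w * D = 1 ∧
      a * algebraMap _ K D = algebraMap _ K A ∧ b * algebraMap _ K D = algebraMap _ K B := by
  have hinj : Function.Injective (algebraMap k[X] K) := IsFractionRing.injective _ _
  obtain ⟨A₁, D₁, hD₁, rfl⟩ := IsFractionRing.div_surjective (A := k[X]) a
  obtain ⟨B₂, D₂, hD₂, rfl⟩ := IsFractionRing.div_surjective (A := k[X]) b
  have hD₁ := nonZeroDivisors.ne_zero hD₁
  have hD₂ := nonZeroDivisors.ne_zero hD₂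
  have h₁ : algebraMap k[X] K D₁ ≠ 0 := by simpa using hD₁
  have h₂ : algebraMap k[X] K D₂ ≠ 0 := by simpa using hD₂
  obtain ⟨h, hh⟩ := (IsPrincipalIdealRing.principal
    (Ideal.span {A₁ * D₂, B₂ * D₁, D₁ * D₂})).principal
  have hmem : ∀ x ∈ ({A₁ * D₂, B₂ * D₁, D₁ * D₂} : Set k[X]), h ∣ x := fun x hx ↦
    Ideal.mem_span_singleton.mp (hh.le (Ideal.subset_span hx))
  obtain ⟨A, hA⟩ := hmem (A₁ * D₂) (by simp)
  obtain ⟨B, hB⟩ := hmem (B₂ * D₁) (by simp)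
  obtain ⟨D, hD⟩ := hmem (D₁ * D₂) (by simp)
  have hne : h * D ≠ 0 := hD ▸ mul_ne_zero hD₁ hD₂
  have hh0 := left_ne_zero_of_mul hne
  have hK : algebraMap k[X] K h ≠ 0 := by simpa using hh0
  have hh' : h ∈ Ideal.span {A₁ * D₂, B₂ * D₁, D₁ * D₂} := hh.ge (Ideal.mem_span_singleton_self h)
  obtain ⟨u, z, hz, e₁⟩ := Ideal.mem_span_insert.mp hh'
  obtain ⟨v, w, e₂⟩ := Ideal.mem_span_pair.mp hz
  refine ⟨A, B, D, u, v, w, right_ne_zero_of_mul hne, ?_, ?_, ?_⟩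
  · apply mul_left_cancel₀ hh0
    linear_combination -e₁ + e₂ - u * hA - v * hB - w * hD
  · have e₁ := congrArg (algebraMap k[X] K) hA
    have e₂ := congrArg (algebraMap k[X] K) hD
    simp only [map_mul] at e₁ e₂
    rw [div_mul_eq_mul_div, div_eq_iff h₁]
    apply mul_left_cancel₀ hK
    linear_combination algebraMap _ K D₁ * e₁ - algebraMap _ K A₁ * e₂
  · have e₁ := congrArg (algebraMap k[X] K) hB
    have e₂ := congrArg (algebraMap k[X] K) hD
    simp only [map_mul] at e₁ e₂
    rw [div_mul_eq_mul_div, div_eq_iff h₂]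
    apply mul_left_cancel₀ hK
    linear_combination algebraMap _ K D₂ * e₁ - algebraMap _ K B₂ * e₂

lemma mem_range_of_eval₂_eq_zero [IsAlgClosed k] {K : Type*} [Field K] (φ : k →+* K)
    {f : k[X]} (hf : f ≠ 0) {a : K} (ha : f.eval₂ φ a = 0) : ∃ r, φ r = a := by
  have h := (IsAlgClosed.splits f).eq_prod_roots
  rw [h, Polynomial.eval₂_mul, Polynomial.eval₂_C, mul_eq_zero] at ha
  rcases ha with ha | ha
  · simp [hf] at ha
  · rw [Polynomial.eval₂_multiset_prod, Multiset.map_map, Multiset.prod_eq_zero_iff,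
      Multiset.mem_map] at ha
    obtain ⟨r, -, hr⟩ := ha
    refine ⟨r, ?_⟩
    simpa [sub_eq_zero, eq_comm (a := a)] using hr

/-- If `G (s(a) - b^p) = 1`, where `s` has no constant term, is of degree less than `p` and has
linear term `X`, and `G`, `G a^p`, `G b^p` are polynomials, then `a` is a `p`-th power. -/
lemma exists_pow_eq_of_mul_sub_pow_eq_one [IsAlgClosed k] {K : Type*} [Field K] [Algebra k[X] K]
    [IsFractionRing k[X] K] {c : ℕ → k} (hc : c 1 = 1) {a b : K} {g g₁ g₂ : k[X]}
    (h₁ : algebraMap _ K g₁ = algebraMap _ K g * a ^ p)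
    (h₂ : algebraMap _ K g₂ = algebraMap _ K g * b ^ p)
    (h : algebraMap _ K g * (∑ i ∈ Icc 1 (p - 1), algebraMap _ K (Polynomial.C (c i)) * a ^ i
      - b ^ p) = 1) : ∃ α : K, α ^ p = a := by
  obtain ⟨A, B, D, u, v, w, hD, huvw, hA, hB⟩ := exists_bezout_fractions (k := k) a b
  have hinj : Function.Injective (algebraMap k[X] K) := IsFractionRing.injective _ _
  have hDK : algebraMap k[X] K D ≠ 0 := by simpa using hD
  set S : k[X] := ∑ i ∈ Icc 1 (p - 1), Polynomial.C (c i) * A ^ i * D ^ (p - i) with hS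
  have hSK : algebraMap k[X] K S =
      (∑ i ∈ Icc 1 (p - 1), algebraMap _ K (Polynomial.C (c i)) * a ^ i)
      * algebraMap k[X] K D ^ p := by
    rw [hS, map_sum, Finset.sum_mul]
    refine Finset.sum_congr rfl fun i hi ↦ ?_
    have hi := Finset.mem_Icc.mp hi
    have : p = i + (p - i) := by omega
    rw [map_mul, map_mul, map_pow, map_pow, ← hA, mul_pow]
    conv_rhs => rw [this, pow_add]
    ring
  -- Frobenius turns the Bézout identity into one between `p`-th powers, as needed to use `g`, `g₁`,
  -- `g₂`.
  have hpow : u ^ p * A ^ p + v ^ p * B ^ p + w ^ p * D ^ p = 1 := by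
    rw [← mul_pow, ← mul_pow, ← mul_pow, ← add_pow_char, ← add_pow_char, huvw, one_pow]
  -- Here `S - Bᵖ = Dᵖ (s(a) - bᵖ)` has inverse `g / Dᵖ`; multiplying by `hpow` shows that this
  -- inverse is a polynomial. So `S - Bᵖ` is a constant.
  have hunit : (u ^ p * g₁ + v ^ p * g₂ + w ^ p * g) * (S - B ^ p) = 1 := by
    apply hinj
    have e := congrArg (algebraMap k[X] K) hpow
    simp only [map_mul, map_sub, map_add, map_pow, map_one, hSK, h₁, h₂, ← hA, ← hB] at e ⊢
    linear_combination (algebraMap _ K g * (∑ i ∈ Icc 1 (p - 1),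
      algebraMap _ K (Polynomial.C (c i)) * a ^ i - b ^ p)) * e + h
  obtain ⟨κ, -, hκ⟩ := Polynomial.isUnit_iff.mp (IsUnit.of_mul_eq_one_right _ hunit)
  have hder : derivative S = 0 := by
    have : S = Polynomial.C κ + B ^ p := by rw [hκ]; ring
    rw [this, derivative_add, derivative_C, derivative_pow]
    simp
  rw [hS, derivative_sum_homogeneous, mul_eq_zero] at hder
  rcases hder with hT | hW
  -- `T(A, D) = 0` dehomogenizes to `f(a) = 0`, where `f` has constant term `c 1 = 1`. So `a` lies
  -- in the algebraically closed field `k`.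
  · let f : k[X] := ∑ i ∈ Icc 1 (p - 1), Polynomial.C (i * c i) * Polynomial.X ^ (i - 1)
    have hf : f ≠ 0 := by
      intro h0
      have := congrArg (fun f ↦ Polynomial.coeff f 0) h0
      simp only [f, Polynomial.finsetSum_coeff, Polynomial.coeff_C_mul, Polynomial.coeff_X_pow,
        Polynomial.coeff_zero] at this
      have h2 := hp.out.two_le
      rw [Finset.sum_eq_single 1] at this
      · simp [hc] at this
      · intro i hi hi1
        have := Finset.mem_Icc.mp hi
        rw [if_neg (by omega), mul_zero]
      · intro hn
        exact absurd (Finset.mem_Icc.mpr ⟨le_rfl, by omega⟩) hn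
    obtain ⟨r, rfl⟩ := mem_range_of_eval₂_eq_zero ((algebraMap k[X] K).comp Polynomial.C) hf
      (a := a) (by
        have e := congrArg (algebraMap k[X] K) hT
        rw [map_zero, map_sum] at e
        have : (eval₂ ((algebraMap k[X] K).comp Polynomial.C) a f) *
            algebraMap k[X] K D ^ (p - 2) = 0 := by
          rw [← e, Polynomial.eval₂_finsetSum, Finset.sum_mul]
          refine Finset.sum_congr rfl fun i hi ↦ ?_
          have hi := Finset.mem_Icc.mp hi
          -- `T` is homogeneous of degree `p - 2`.
          have : p - 2 = i - 1 + (p - 1 - i) := by omega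
          rw [this]
          simp only [Polynomial.eval₂_mul, Polynomial.eval₂_C, Polynomial.eval₂_pow,
            Polynomial.eval₂_X, RingHom.comp_apply, map_mul, map_pow, ← hA, mul_pow, pow_add]
          ring
        exact (mul_eq_zero.mp this).resolve_right (pow_ne_zero _ hDK))
    obtain ⟨s, hs⟩ := IsAlgClosed.exists_pow_nat_eq r hp.out.pos
    exact ⟨algebraMap k[X] K (Polynomial.C s), by rw [← map_pow, ← map_pow, hs]; rfl⟩
  -- Now the Wronskian vanishes, and `(A D^{p-1})' = D^{p-2} (A'D - AD') = 0`. Hence `A D^{p-1}` is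
  -- a `p`-th power, and so is `a = A D^{p-1} / Dᵖ`.
  · obtain ⟨m, hm⟩ : ∃ m, p = m + 2 := ⟨p - 2, by have := hp.out.two_le; omega⟩
    obtain ⟨h, hh⟩ := exists_pow_eq_of_derivative_eq_zero (p := p) (f := A * D ^ (m + 1)) (by
      have e3 : ((m + 1 : ℕ) : k[X]) = - 1 := by
        have : ((m + 2 : ℕ) : k[X]) = 0 := by rw [← hm, CharP.cast_eq_zero]
        push_cast at this ⊢
        linear_combination this
      rw [derivative_mul, derivative_pow_succ]
      push_cast at e3
      simp only [map_add, map_natCast, map_one]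
      linear_combination A * D ^ m * derivative D * e3 + D ^ m * hW)
    refine ⟨algebraMap _ K h / algebraMap _ K D, ?_⟩
    rw [div_pow, ← map_pow, hh, map_mul, ← hA, map_pow, div_eq_iff (pow_ne_zero _ hDK)]
    conv_rhs => rw [hm]
    ring

end PthPower

/-! ### Irreducibility of the equation of `Δ_X` -/

section Irreducibility

open Polynomial in
-- Eisenstein's criterion at `π`, which divides `a` exactly once.
lemma prime_X_pow_sub_C_of_dvd {R : Type*} [CommRing R] [IsDomain R] [UniqueFactorizationMonoid R]
    {π a : R} (hπ : Prime π) {ρ : R} (ha : a = π * ρ) (hρ : ¬ π ∣ ρ) {n : ℕ} (hn : 0 < n) :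
    Prime (Polynomial.X ^ n - Polynomial.C a : R[X]) := by
  rw [← UniqueFactorizationMonoid.irreducible_iff_prime]
  have hm := monic_X_pow_sub_C a hn.ne'
  have hP : (Ideal.span {π}).IsPrime := (Ideal.span_singleton_prime hπ.ne_zero).mpr hπ
  refine irreducible_of_eisenstein_criterion hP ?_ ?_ ?_ ?_ hm.isPrimitive
  · rw [hm.leadingCoeff]
    exact fun h ↦ hP.ne_top ((Ideal.eq_top_iff_one _).mpr h)
  · intro m hmn
    rw [degree_X_pow_sub_C hn, Nat.cast_lt] at hmn
    rw [Polynomial.coeff_sub, Polynomial.coeff_X_pow, if_neg hmn.ne, Polynomial.coeff_C, zero_sub]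
    split_ifs
    · rw [ha, neg_mem_iff]
      exact Ideal.mem_span_singleton.mpr (dvd_mul_right _ _)
    · simp
  · rw [degree_X_pow_sub_C hn]
    exact_mod_cast hn
  · rw [Polynomial.coeff_sub, Polynomial.coeff_X_pow, if_neg hn.ne, Polynomial.coeff_C_zero,
      zero_sub, neg_mem_iff, Ideal.span_singleton_pow, Ideal.mem_span_singleton, ha, pow_two]
    exact fun h ↦ hρ ((mul_dvd_mul_iff_left hπ.ne_zero).mp h)

variable {k : Type u} [Field k]

variable (k) in
-- Makes `x₂` the main variable. The swap is there because `finSuccEquiv` singles out the variable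
-- of index `0`.
lemma exists_algEquiv_polynomial :
    ∃ e : MvPolynomial (Fin 3) k ≃ₐ[k] Polynomial (MvPolynomial (Fin 2) k),
      e (X 0) = Polynomial.C (X 1) ∧ e (X 1) = Polynomial.C (X 0) ∧ e (X 2) = Polynomial.X ∧
        ∀ r, e (C r) = Polynomial.C (C r) := by
  have h (i : Fin 3) : renameEquiv k (Equiv.swap (0 : Fin 3) 2) (X i) =
      X (Equiv.swap (0 : Fin 3) 2 i) := by
    rw [renameEquiv_apply, rename_X]
  refine ⟨(renameEquiv k (Equiv.swap (0 : Fin 3) 2)).trans (finSuccEquiv k 2), ?_, ?_, ?_, ?_⟩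
  · rw [AlgEquiv.trans_apply, h, Equiv.swap_apply_left]
    exact finSuccEquiv_X_succ (j := 1)
  · rw [AlgEquiv.trans_apply, h, Equiv.swap_apply_of_ne_of_ne (by decide) (by decide)]
    exact finSuccEquiv_X_succ (j := 0)
  · rw [AlgEquiv.trans_apply, h, Equiv.swap_apply_right]
    exact finSuccEquiv_X_zero
  · intro r
    exact AlgEquiv.commutes _ r

/-- Eisenstein at `x₀`, which corresponds to `X 1` under `e`: the cofactor `ρ` of `x₀` in `σ` is
`x₁^{p-1}` modulo `x₀`, since `c 1 = 1`. -/
lemma prime_sigma_sub_X_pow {p : ℕ} (hp : 2 ≤ p) (c : ℕ → k) (hc : c 1 = 1) :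
    Prime (sigma p c - X 2 ^ p) := by
  obtain ⟨e, e0, e1, e2, eC⟩ := exists_algEquiv_polynomial k
  let ρ : MvPolynomial (Fin 2) k :=
    ∑ i ∈ Finset.Icc 1 (p - 1), C (c i) * X 1 ^ (i - 1) * X 0 ^ (p - i)
  have h := prime_X_pow_sub_C_of_dvd (X_prime (R := k) (i := (1 : Fin 2))) (ρ := ρ) rfl (by
    rintro ⟨m, hm⟩
    have := congrArg (eval ![1, 0]) hm
    simp only [ρ, map_sum, map_mul, map_pow, eval_X, eval_C] at this
    rw [Finset.sum_eq_single 1] at this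
    · simp [hc] at this
    · intro i hi hi1
      have hi := Finset.mem_Icc.mp hi
      simp [show i - 1 ≠ 0 by omega]
    · intro hn
      exact absurd (Finset.mem_Icc.mpr ⟨le_rfl, by omega⟩) hn) (by omega : 0 < p)
  rw [← MulEquiv.prime_iff e, ← neg_neg (e _)]
  refine Prime.neg ?_
  convert h using 1
  rw [map_sub, map_pow, e2, neg_sub, sigma, map_sum, Finset.mul_sum, map_sum]
  congr 1
  refine Finset.sum_congr rfl fun i hi ↦ ?_
  have hi := Finset.mem_Icc.mp hi
  obtain ⟨j, rfl⟩ : ∃ j, i = j + 1 := ⟨i - 1, by omega⟩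
  simp only [map_mul, map_pow, e0, e1, eC, Nat.add_sub_cancel]
  ring

end Irreducibility

/-! ### Properties of `projMapMul` -/

lemma isIntegralHom_of_openCover {X Y : Scheme.{u}} (f : X ⟶ Y) (𝒰 : Y.OpenCover)
    [∀ i, IsAffine (𝒰.X i)] (h : ∀ i, IsIntegralHom (𝒰.pullbackHom f i)) : IsIntegralHom f :=
  @HasAffineProperty.of_openCover _ _ IsIntegralHom.hasAffineProperty X Y f 𝒰 _ fun i ↦
    (@HasAffineProperty.iff_of_isAffine _ _ IsIntegralHom.hasAffineProperty _ _ _ _).mp (h i)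

section ProjMapMul

open HomogeneousLocalization

variable {A B : Type u} [CommRing A] [CommRing B] {α β : Type*}
  [SetLike α A] [SetLike β B] {𝒜 : ℕ → α} {ℬ : ℕ → β}
  [AddSubgroupClass α A] [AddSubgroupClass β B] [GradedRing 𝒜] [GradedRing ℬ]
  {d : ℕ} (hd : 0 < d) (φ : A →+* B) (hφ : ∀ n, ∀ a ∈ 𝒜 n, φ a ∈ ℬ (d * n))
  (hcov : ∀ P : ProjectiveSpectrum ℬ, ∃ s : PosHomogeneous 𝒜, φ s.2 ∉ P.asHomogeneousIdeal)

lemma awayMk_pow {m : ℕ} {s : A} (hs : s ∈ 𝒜 m) (n : ℕ) {a : A} (ha : a ∈ 𝒜 (n • m)) (e : ℕ) :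
    Away.mk 𝒜 hs n a ha ^ e = Away.mk 𝒜 hs (n * e) (a ^ e)
      (by convert SetLike.pow_mem_graded e ha using 2; simp [mul_comm, mul_left_comm]) := by
  ext
  rw [val_pow, Away.val_mk, Away.val_mk, Localization.mk_pow]
  congr 1
  ext
  simp [pow_mul]

lemma awayMk_congr {m : ℕ} {s : A} (hs : s ∈ 𝒜 m) {n : ℕ} {a b : A} (h : a = b)
    (ha : a ∈ 𝒜 (n • m)) : Away.mk 𝒜 hs n a ha = Away.mk 𝒜 hs n b (h ▸ ha) := by
  subst h
  rfl

lemma awayMapMul_fromZeroRingHom (s : A) (a : 𝒜 0) :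
    awayMapMul φ hφ s (fromZeroRingHom 𝒜 _ a) = fromZeroRingHom ℬ _ ⟨φ a, hφ 0 a a.2⟩ := by
  ext
  rw [val_awayMapMul]
  exact IsLocalization.map_eq _ _

/-- The element is `tᵐ / sⁿ`, with the degrees as exponents; `φ` multiplies both degrees by `d`. -/
lemma awayMapMul_isLocalizationElem {m n : ℕ} {s t : A} (hs : s ∈ 𝒜 m) (ht : t ∈ 𝒜 n) :
    awayMapMul φ hφ s (Away.isLocalizationElem hs ht) ^ d =
      Away.isLocalizationElem (hφ _ _ hs) (hφ _ _ ht) := by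
  rw [Away.isLocalizationElem, awayMapMul_mk]
  ext
  rw [val_pow, Away.val_mk, Away.isLocalizationElem, Away.val_mk, Localization.mk_pow]
  congr 1
  · simp [← pow_mul, mul_comm]
  · ext
    simp [← pow_mul, mul_comm]

omit [AddSubgroupClass α A] [GradedRing 𝒜] in
include hcov in
lemma exists_homogeneous_notMem (x : Proj ℬ) :
    ∃ (m : ℕ) (_ : 0 < m) (s : A), s ∈ 𝒜 m ∧ x ∈ Proj.basicOpen ℬ (φ s) := by
  obtain ⟨⟨m, s, hs⟩, h⟩ := hcov x
  exact ⟨m, m.pos, s, hs, h⟩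

lemma projMapMul_preimage_basicOpen {n : ℕ} (hn : 0 < n) {t : A} (ht : t ∈ 𝒜 n) :
    projMapMul hd φ hφ hcov ⁻¹ᵁ Proj.basicOpen 𝒜 t = Proj.basicOpen ℬ (φ t) := by
  ext x
  obtain ⟨m, hm, s, hs, hxs⟩ := exists_homogeneous_notMem φ hcov x
  have hx : x ∈ (Proj.awayι ℬ (φ s) (hφ _ _ hs) (Nat.mul_pos hd hm)).opensRange := by
    rwa [Proj.opensRange_awayι]
  obtain ⟨y, rfl⟩ := hx
  have e₁ : projMapMul hd φ hφ hcov (Proj.awayι ℬ (φ s) (hφ _ _ hs) (Nat.mul_pos hd hm) y) =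
      Proj.awayι 𝒜 s hs hm (Spec.map (CommRingCat.ofHom (awayMapMul φ hφ s)) y) := by
    rw [← Scheme.Hom.comp_apply, ← Scheme.Hom.comp_apply, awayι_projMapMul]
  have e₂ := Proj.awayι_preimage_basicOpen 𝒜 hs hm ht hn
  have e₃ := Proj.awayι_preimage_basicOpen ℬ (hφ _ _ hs) (Nat.mul_pos hd hm) (hφ _ _ ht)
    (Nat.mul_pos hd hn)
  -- A `d`-th power has the same basic open set, so the change of degrees does no harm.
  rw [← awayMapMul_isLocalizationElem φ hφ hs ht, PrimeSpectrum.basicOpen_pow _ _ hd] at e₃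
  have h₂ := SetLike.ext_iff.mp e₂ (Spec.map (CommRingCat.ofHom (awayMapMul φ hφ s)) y)
  have h₃ := SetLike.ext_iff.mp e₃ y
  change projMapMul hd φ hφ hcov _ ∈ Proj.basicOpen 𝒜 t ↔ _
  rw [e₁]
  exact h₂.trans h₃.symm

lemma isPullback_projMapMul {m : ℕ} (hm : 0 < m) {s : A} (hs : s ∈ 𝒜 m) :
    IsPullback (Spec.map (CommRingCat.ofHom (awayMapMul φ hφ s)))
      (Proj.awayι ℬ (φ s) (hφ _ _ hs) (Nat.mul_pos hd hm)) (Proj.awayι 𝒜 s hs hm)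
      (projMapMul hd φ hφ hcov) :=
  IsOpenImmersion.isPullback _ _ _ _ (awayι_projMapMul hd φ hφ hcov hm s hs) (by
    rw [Proj.opensRange_awayι, Proj.opensRange_awayι,
      projMapMul_preimage_basicOpen hd φ hφ hcov hm hs])

lemma isIntegralHom_projMapMul
    (h : ∀ (m : ℕ) (_ : 0 < m) (s : A) (_ : s ∈ 𝒜 m), (awayMapMul φ hφ s).IsIntegral) :
    IsIntegralHom (projMapMul hd φ hφ hcov) := by
  have haff : ∀ i, IsAffine ((Proj.affineOpenCover 𝒜).openCover.X i) := fun i ↦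
    inferInstanceAs (IsAffine (Spec ((Proj.affineOpenCover 𝒜).X i)))
  refine isIntegralHom_of_openCover _ (Proj.affineOpenCover 𝒜).openCover ?_
  rintro ⟨m, s, hs⟩
  have hp := (isPullback_projMapMul hd φ hφ hcov m.pos hs).flip
  change IsIntegralHom (Limits.pullback.snd _ (Proj.awayι 𝒜 s hs m.pos))
  rw [← hp.isoPullback_inv_snd]
  have : IsIntegralHom (Spec.map (CommRingCat.ofHom (awayMapMul φ hφ s))) :=
    IsIntegralHom.SpecMap_iff.mpr (h m m.pos s hs)
  infer_instance

lemma projMapMul_comp_eq {S : Scheme.{u}} {f : Proj ℬ ⟶ S} {g : Proj 𝒜 ⟶ S}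
    (h : ∀ (m : ℕ) (hm : 0 < m) (s : A) (hs : s ∈ 𝒜 m),
      Spec.map (CommRingCat.ofHom (awayMapMul φ hφ s)) ≫ Proj.awayι 𝒜 s hs hm ≫ g =
        Proj.awayι ℬ (φ s) (hφ _ _ hs) (Nat.mul_pos hd hm) ≫ f) :
    projMapMul hd φ hφ hcov ≫ g = f := by
  refine (projMapMulCover hd φ hφ hcov).openCover.hom_ext _ _ ?_
  rintro ⟨m, s, hs⟩
  exact (Category.assoc _ _ _).symm.trans ((congrArg (· ≫ g)
    (awayι_projMapMul hd φ hφ hcov m.pos s hs)).trans ((Category.assoc _ _ _).trans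
      (h m m.pos s hs)))

/-- A morphism from the spectrum of a field factors through a chart. -/
lemma exists_awayι_of_mem_basicOpen {R : CommRingCat.{u}} {m : ℕ} (hm : 0 < m) {s : A}
    (hs : s ∈ 𝒜 m) (z : Spec R ⟶ Proj 𝒜) (hz : ∀ x, z x ∈ Proj.basicOpen 𝒜 s) :
    ∃ ψ : Away 𝒜 s →+* R, z = Spec.map (CommRingCat.ofHom ψ) ≫ Proj.awayι 𝒜 s hs hm := by
  have h : Set.range z ⊆ Set.range (Proj.awayι 𝒜 s hs hm) := by
    rintro _ ⟨x, rfl⟩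
    have : z x ∈ (Proj.awayι 𝒜 s hs hm).opensRange := by
      rw [Proj.opensRange_awayι]; exact hz x
    exact this
  obtain ⟨ψ, hψ⟩ := Spec.map_surjective (IsOpenImmersion.lift (Proj.awayι 𝒜 s hs hm) z h)
  exact ⟨ψ.hom, by rw [CommRingCat.ofHom_hom, hψ, IsOpenImmersion.lift_fac]⟩

/-- The composite determines the values of all `p`-th powers of functions on a chart, and `p`-th
roots in `K` are unique. Both points lie in one chart because `D₊(φ s)` is the preimage of `D₊(s)`.
-/
lemma projMapMul_cancel {K : Type u} [Field K] {p : ℕ}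
    (hK : Function.Injective fun x : K ↦ x ^ p)
    (h : ∀ (m : ℕ) (_ : 0 < m) (s : A) (_ : s ∈ 𝒜 m), ∀ y, ∃ a, awayMapMul φ hφ s a = y ^ p)
    {z z' : Spec (.of K) ⟶ Proj ℬ}
    (hz : z ≫ projMapMul hd φ hφ hcov = z' ≫ projMapMul hd φ hφ hcov) : z = z' := by
  have hsub : Subsingleton (Spec (.of K)) := inferInstanceAs (Subsingleton (PrimeSpectrum K))
  let x : Spec (.of K) := (⊥ : PrimeSpectrum K)
  obtain ⟨m, hm, s, hs, h₁⟩ := exists_homogeneous_notMem φ hcov (z x)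
  have h₂ : z' x ∈ Proj.basicOpen ℬ (φ s) := by
    rw [← projMapMul_preimage_basicOpen hd φ hφ hcov hm hs] at h₁ ⊢
    change (z' ≫ projMapMul hd φ hφ hcov) x ∈ Proj.basicOpen 𝒜 s
    rw [← hz]
    exact h₁
  obtain ⟨ψ, rfl⟩ := exists_awayι_of_mem_basicOpen (Nat.mul_pos hd hm) (hφ _ _ hs) z
    fun y ↦ Subsingleton.elim x y ▸ h₁
  obtain ⟨ψ', rfl⟩ := exists_awayι_of_mem_basicOpen (Nat.mul_pos hd hm) (hφ _ _ hs) z'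
    fun y ↦ Subsingleton.elim x y ▸ h₂
  rw [Category.assoc, Category.assoc, awayι_projMapMul hd φ hφ hcov hm s hs, ← Category.assoc,
    ← Category.assoc, cancel_mono, ← Spec.map_comp, ← Spec.map_comp, Spec.map_inj] at hz
  congr 3
  ext y
  obtain ⟨a, ha⟩ := h m hm s hs y
  refine hK ?_
  have := congr(($hz).hom a)
  simp only [CommRingCat.hom_comp, CommRingCat.hom_ofHom, RingHom.comp_apply, ha, map_pow] at this
  exact this

end ProjMapMul

/-! ### The morphism from `ℙ(1, 1, p)` to `ℙ²` -/

section MapZX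

open HomogeneousLocalization

variable {k : Type u} [Field k]

/-- The constant functions on a chart of a weighted projective space. -/
def awayConst {n : ℕ} (w : Fin n → ℕ) (s : MvPolynomial (Fin n) k) :
    k →+* Away (weightedHomogeneousSubmodule k w) s :=
  (HomogeneousLocalization.fromZeroRingHom (weightedHomogeneousSubmodule k w) _).comp
    (algebraMap k (weightedHomogeneousSubmodule k w 0))

lemma awayι_toSpec {n m : ℕ} (w : Fin n → ℕ) {s : MvPolynomial (Fin n) k} (hm : 0 < m)
    (hs : s ∈ weightedHomogeneousSubmodule k w m) :
    Proj.awayι _ s hs hm ≫ WProj.toSpec k w = Spec.map (CommRingCat.ofHom (awayConst w s)) := by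
  rw [WProj.toSpec, ← Category.assoc, Proj.awayι_toSpecZero, ← Spec.map_comp]
  rfl

lemma mem_zeros_iff {n : ℕ} (w : Fin n → ℕ) (F : MvPolynomial (Fin n) k) (x : WProj k w) :
    x ∈ WProj.zeros k w F ↔ x ∉ Proj.basicOpen (weightedHomogeneousSubmodule k w) F :=
  Set.singleton_subset_iff.trans not_not.symm

lemma sigma_sub_mem (p : ℕ) (c : ℕ → k) :
    sigma p c - X 2 ^ p ∈ weightedHomogeneousSubmodule k ![1, 1, 1] p := by
  refine Submodule.sub_mem _ ?_ ?_
  · refine IsWeightedHomogeneous.sum _ _ _ fun i hi ↦ ?_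
    have h := (((isWeightedHomogeneous_X k ![1, 1, 1] (0 : Fin 3)).pow i).C_mul (c i)).mul
      ((isWeightedHomogeneous_X k ![1, 1, 1] (1 : Fin 3)).pow (p - i))
    have hi' := Finset.mem_Icc.mp hi
    convert h using 1
    simp
    omega
  · convert (isWeightedHomogeneous_X k ![1, 1, 1] (2 : Fin 3)).pow p using 1
    simp

variable (p : ℕ) [Fact p.Prime] [CharP k p]

lemma sigmaRoot_pow [PerfectRing k p] (c : ℕ → k) :
    sigmaRoot p c ^ p = substZX p c (sigma p c) := by
  simp only [sigmaRoot, sigma, map_sum, map_mul, map_pow, sum_pow_char, mul_pow, substZX, aeval_X,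
    aeval_C, Matrix.cons_val_zero, Matrix.cons_val_one, ← C_pow, algebraMap_eq,
    frobeniusEquiv_symm_pow_p, ← pow_mul, mul_comm p]

/-- `q` becomes `(σ^{1/p})ᵖ - (σ^{1/p} - z₂)ᵖ`. This is the source of both `F⁻¹(Δ_X) = Δ_Z` and the
factor `p` between contact orders. -/
lemma substZX_boundary [PerfectRing k p] (c : ℕ → k) :
    substZX p c (sigma p c - X 2 ^ p) = X 2 ^ p := by
  rw [map_sub, ← sigmaRoot_pow, map_pow, substZX, aeval_X]
  simp [sub_pow_char]

/-- A form `H` of degree `n` on `ℙ(1, 1, p)` has a `p`-th power that comes from `ℙ²`. -/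
lemma exists_substZX_eq_pow [PerfectRing k p] (c : ℕ → k) {n : ℕ} {H : MvPolynomial (Fin 3) k}
    (hH : H ∈ weightedHomogeneousSubmodule k ![1, 1, p] n) :
    ∃ G ∈ weightedHomogeneousSubmodule k ![1, 1, 1] n, substZX p c G = H ^ p := by
  -- The substitution sends `x₀, x₁, q` to `z₀ᵖ, z₁ᵖ, z₂ᵖ`, so inserting them in `H` with its
  -- coefficients raised to the `p`-th power gives `G`. Degrees match since `q` has degree `p`, the
  -- weight of `z₂`.
  let v : Fin 3 → MvPolynomial (Fin 3) k := ![X 0, X 1, sigma p c - X 2 ^ p]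
  have hv (i : Fin 3) : IsWeightedHomogeneous ![1, 1, 1] (v i) (![1, 1, p] i) := by
    fin_cases i
    · exact isWeightedHomogeneous_X k ![1, 1, 1] (0 : Fin 3)
    · exact isWeightedHomogeneous_X k ![1, 1, 1] (1 : Fin 3)
    · exact sigma_sub_mem p c
  refine ⟨eval₂Hom (C.comp (frobenius k p)) v H, ?_, ?_⟩
  · rw [coe_eval₂Hom, eval₂_eq']
    refine IsWeightedHomogeneous.sum _ _ _ fun d hd ↦ IsWeightedHomogeneous.C_mul ?_ _
    convert IsWeightedHomogeneous.prod Finset.univ _ (fun i : Fin 3 ↦ d i • ![1, 1, p] i)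
      fun i _ ↦ (hv i).pow (d i) using 1
    have hn := hH (mem_support_iff.mp hd)
    rwa [Finsupp.weight_apply, Finsupp.sum_fintype _ _ (by simp), eq_comm] at hn
  · have : (substZX p c : _ →+* _).comp (eval₂Hom (C.comp (frobenius k p)) v) =
        frobenius (MvPolynomial (Fin 3) k) p := by
      refine MvPolynomial.ringHom_ext (fun a ↦ ?_) fun i ↦ ?_
      · simp [frobenius_def, substZX]
      · fin_cases i
        · simp [frobenius_def, v, substZX]
        · simp [frobenius_def, v, substZX]
        · simpa [frobenius_def, v] using substZX_boundary p c
    exact congr($this H)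

variable [PerfectRing k p] (c : ℕ → k)

/-- The morphism `mapZX` on the charts `D₊(φ s) ⟶ D₊(s)`. -/
def awayZX (s : MvPolynomial (Fin 3) k) :
    Away (weightedHomogeneousSubmodule k ![1, 1, 1]) s →+*
      Away (weightedHomogeneousSubmodule k ![1, 1, p]) (substZX p c s) := by
  refine awayMapMul (d := p) (𝒜 := weightedHomogeneousSubmodule k ![1, 1, 1])
    (ℬ := weightedHomogeneousSubmodule k ![1, 1, p])
    (substZX p c : MvPolynomial (Fin 3) k →+* MvPolynomial (Fin 3) k) ?_ s
  exact substZX_mem p c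

lemma awayZX_mk {m : ℕ} {s : MvPolynomial (Fin 3) k}
    (hs : s ∈ weightedHomogeneousSubmodule k ![1, 1, 1] m) (n : ℕ) (a : MvPolynomial (Fin 3) k)
    (ha : a ∈ weightedHomogeneousSubmodule k ![1, 1, 1] (n • m)) :
    awayZX p c s (Away.mk _ hs n a ha) =
      Away.mk (weightedHomogeneousSubmodule k ![1, 1, p]) (substZX_mem p c _ _ hs) n
        (substZX p c a) (by
        have := substZX_mem p c _ _ ha; rwa [smul_eq_mul, mul_left_comm] at this) :=
  awayMapMul_mk _ _ s hs n a ha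

lemma awayι_mapZX {m : ℕ} (hm : 0 < m) {s : MvPolynomial (Fin 3) k}
    (hs : s ∈ weightedHomogeneousSubmodule k ![1, 1, 1] m) :
    Proj.awayι (weightedHomogeneousSubmodule k ![1, 1, p]) (substZX p c s) (substZX_mem p c _ _ hs)
        (Nat.mul_pos (Nat.Prime.pos Fact.out) hm) ≫ mapZX p c =
      Spec.map (CommRingCat.ofHom (awayZX p c s)) ≫
        Proj.awayι (weightedHomogeneousSubmodule k ![1, 1, 1]) s hs hm :=
  awayι_projMapMul _ _ _ _ hm s hs

lemma mapZX_preimage_basicOpen {m : ℕ} (hm : 0 < m) {s : MvPolynomial (Fin 3) k}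
    (hs : s ∈ weightedHomogeneousSubmodule k ![1, 1, 1] m) :
    mapZX p c ⁻¹ᵁ Proj.basicOpen (weightedHomogeneousSubmodule k ![1, 1, 1]) s =
      Proj.basicOpen (weightedHomogeneousSubmodule k ![1, 1, p]) (substZX p c s) :=
  projMapMul_preimage_basicOpen _ _ _ _ hm hs

lemma exists_awayZX_eq_pow {m : ℕ} {s : MvPolynomial (Fin 3) k}
    (hs : s ∈ weightedHomogeneousSubmodule k ![1, 1, 1] m)
    (y : Away (weightedHomogeneousSubmodule k ![1, 1, p]) (substZX p c s)) :
    ∃ a, awayZX p c s a = y ^ p := by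
  obtain ⟨n, H, hH, rfl⟩ := Away.mk_surjective _ (substZX_mem p c _ _ hs) y
  obtain ⟨G, hG, h⟩ := exists_substZX_eq_pow p c hH
  refine ⟨Away.mk _ hs (n * p) G (by convert hG using 2; simp [mul_assoc]), ?_⟩
  exact (awayZX_mk p c hs _ G _).trans ((awayMk_congr _ h _).trans
    (awayMk_pow (substZX_mem p c _ _ hs) n hH p).symm)

/-- Each function `y` on a chart of `Z` is a root of `Xᵖ - a` with `a` from `X`. -/
lemma isIntegralHom_mapZX : IsIntegralHom (mapZX p c) := by
  refine isIntegralHom_projMapMul _ _ _ _ fun m _ s hs y ↦ ?_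
  obtain ⟨a, ha⟩ := exists_awayZX_eq_pow p c hs y
  refine ⟨Polynomial.X ^ p - Polynomial.C a,
    Polynomial.monic_X_pow_sub_C _ (Nat.Prime.ne_zero Fact.out), ?_⟩
  rw [Polynomial.eval₂_sub, Polynomial.eval₂_X_pow, Polynomial.eval₂_C, sub_eq_zero]
  exact ha.symm

lemma mapZX_cancel {K : Type u} [Field K] [CharP K p]
    {z z' : Spec (.of K) ⟶ (pairZ k p).space} (h : z ≫ mapZX p c = z' ≫ mapZX p c) : z = z' :=
  projMapMul_cancel _ _ _ _ (frobenius_inj K p)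
    (fun _ _ _ hs ↦ exists_awayZX_eq_pow p c hs) h

lemma awayZX_comp_awayConst (s : MvPolynomial (Fin 3) k) :
    (awayZX p c s).comp (awayConst ![1, 1, 1] s) = awayConst ![1, 1, p] (substZX p c s) := by
  refine RingHom.ext fun a ↦
    (awayMapMul_fromZeroRingHom _ (substZX_mem p c) s (algebraMap k _ a)).trans ?_
  exact congrArg (HomogeneousLocalization.fromZeroRingHom _ _)
    (Subtype.ext ((substZX p c).commutes a))

lemma mapZX_toSpec : mapZX p c ≫ (pairX p c).toSpec = (pairZ k p).toSpec := by
  refine projMapMul_comp_eq _ _ _ _ fun m hm s hs ↦ ?_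
  have h₁ := awayι_toSpec ![1, 1, 1] hm hs
  have h₂ := awayι_toSpec ![1, 1, p] (Nat.mul_pos (Nat.Prime.pos Fact.out) hm)
    (substZX_mem p c _ _ hs)
  refine (congrArg _ h₁).trans (Eq.trans ?_ h₂.symm)
  rw [← Spec.map_comp, ← CommRingCat.ofHom_comp]
  exact congrArg (fun f ↦ Spec.map (CommRingCat.ofHom f)) (awayZX_comp_awayConst p c s)

lemma mapZX_preimage_boundary :
    mapZX p c ⁻¹' ((pairX p c).boundary : Set (pairX p c).space) = (pairZ k p).boundary := by
  have hp : 0 < p := Nat.Prime.pos Fact.out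
  have h := mapZX_preimage_basicOpen p c hp (sigma_sub_mem p c)
  rw [substZX_boundary, Proj.basicOpen_pow _ _ _ hp] at h
  ext x
  have hx := not_congr (SetLike.ext_iff.mp h x)
  have h₁ (y : (pairX p c).space) : y ∈ ((pairX p c).boundary : Set _) ↔
      ¬ y ∈ Proj.basicOpen (weightedHomogeneousSubmodule k ![1, 1, 1]) (sigma p c - X 2 ^ p) :=
    mem_zeros_iff _ _ _
  have h₂ : x ∈ ((pairZ k p).boundary : Set _) ↔
      ¬ x ∈ Proj.basicOpen (weightedHomogeneousSubmodule k ![1, 1, p]) (X 2) :=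
    mem_zeros_iff _ _ _
  exact (h₁ _).trans (hx.trans h₂.symm)

end MapZX

/-! ### Evaluation of degree zero fractions -/

section AwayEval

open HomogeneousLocalization

variable {A R : Type u} [CommRing A] [CommRing R] {α : Type*} [SetLike α A]
  [AddSubgroupClass α A] {𝒜 : ℕ → α} [GradedRing 𝒜]

/-- The evaluation `a / sⁿ ↦ ev a / ev sⁿ` of degree zero fractions. -/
def awayEval (ev : A →+* R) {s : A} (hs : IsUnit (ev s)) : Away 𝒜 s →+* R :=
  (IsLocalization.Away.lift (S := Localization.Away s) s hs).comp
    (algebraMap (Away 𝒜 s) (Localization.Away s))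

lemma awayEval_mk_mul (ev : A →+* R) {s : A} (hs : IsUnit (ev s)) {m : ℕ} (hm : s ∈ 𝒜 m) (n : ℕ)
    {a : A} (ha : a ∈ 𝒜 (n • m)) :
    awayEval ev hs (Away.mk 𝒜 hm n a ha) * ev s ^ n = ev a := by
  rw [awayEval, RingHom.comp_apply, HomogeneousLocalization.algebraMap_apply, Away.val_mk,
    Localization.mk_eq_mk', ← map_pow,
    ← IsLocalization.Away.lift_eq (S := Localization.Away s) s hs (s ^ n),
    ← IsLocalization.Away.lift_eq (S := Localization.Away s) s hs a, ← map_mul]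
  congr 1
  exact IsLocalization.mk'_spec (M := Submonoid.powers s) (Localization.Away s) a ⟨s ^ n, n, rfl⟩

lemma awayEval_mk {K : Type u} [Field K] (ev : A →+* K) {s : A} (hs : IsUnit (ev s)) {m : ℕ}
    (hm : s ∈ 𝒜 m) (n : ℕ) {a : A} (ha : a ∈ 𝒜 (n • m)) :
    awayEval ev hs (Away.mk 𝒜 hm n a ha) = ev a / ev s ^ n := by
  rw [eq_div_iff (pow_ne_zero _ hs.ne_zero), awayEval_mk_mul]

lemma eq_awayEval_of_forall_mk (ev : A →+* R) {s : A} (hs : IsUnit (ev s)) {m : ℕ} (hm : s ∈ 𝒜 m)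
    (ψ : Away 𝒜 s →+* R)
    (h : ∀ n a (ha : a ∈ 𝒜 (n • m)), ψ (Away.mk 𝒜 hm n a ha) * ev s ^ n = ev a) :
    ψ = awayEval ev hs := by
  ext x
  obtain ⟨n, a, ha, rfl⟩ := Away.mk_surjective 𝒜 hm x
  refine (hs.pow n).mul_right_cancel ?_
  rw [h, awayEval_mk_mul]

lemma awayEval_comp_awayMap (ev : A →+* R) {s t x : A} {n m : ℕ} (hm : s ∈ 𝒜 m) (ht : t ∈ 𝒜 n)
    (hx : x = s * t) (hu : IsUnit (ev s)) (hux : IsUnit (ev x)) :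
    (awayEval (𝒜 := 𝒜) ev hux).comp (awayMap 𝒜 ht hx) = awayEval ev hu := by
  refine eq_awayEval_of_forall_mk ev hu hm _ fun i a ha ↦ ?_
  have hut : IsUnit (ev t) := by
    rw [hx, map_mul] at hux
    exact isUnit_of_mul_isUnit_right hux
  refine (hut.pow i).mul_right_cancel ?_
  have h := awayEval_mk_mul ev hux (hx ▸ SetLike.mul_mem_graded hm ht) i
    (a := a * t ^ i) (𝒜 := 𝒜) (by
      rw [smul_add]; exact SetLike.mul_mem_graded ha (SetLike.pow_mem_graded _ ht))
  rw [RingHom.comp_apply, awayMap_mk, mul_assoc, ← mul_pow, ← map_mul, ← map_pow, ← map_pow,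
    ← map_mul]
  rw [← map_pow] at h
  convert h using 4
  exact hx.symm

/-- The point of `Proj A` with homogeneous coordinates `ev`. -/
lemma awayEval_awayι {ev : A →+* R} {s t : A} {m n : ℕ} (hm : 0 < m) (hn : 0 < n) (hs : s ∈ 𝒜 m)
    (ht : t ∈ 𝒜 n) (hus : IsUnit (ev s)) (hut : IsUnit (ev t)) :
    Spec.map (CommRingCat.ofHom (awayEval ev hus)) ≫ Proj.awayι 𝒜 s hs hm =
      Spec.map (CommRingCat.ofHom (awayEval ev hut)) ≫ Proj.awayι 𝒜 t ht hn := by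
  have hu : IsUnit (ev (s * t)) := by rw [map_mul]; exact hus.mul hut
  rw [← awayEval_comp_awayMap (𝒜 := 𝒜) ev hs ht rfl hus hu,
    ← awayEval_comp_awayMap (𝒜 := 𝒜) ev ht hs (mul_comm _ _) hut hu,
    CommRingCat.ofHom_comp, CommRingCat.ofHom_comp, Spec.map_comp, Spec.map_comp,
    Category.assoc, Category.assoc, Proj.SpecMap_awayMap_awayι, Proj.SpecMap_awayMap_awayι]
  rfl

lemma isUnit_of_awayEval_mem_basicOpen {K : Type u} [Field K] {ev : A →+* K} {s t : A} {m n : ℕ}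
    (hm : 0 < m) (hn : 0 < n) (hs : s ∈ 𝒜 m) (ht : t ∈ 𝒜 n) (hus : IsUnit (ev s))
    (x : Spec (.of K))
    (hx : (Spec.map (CommRingCat.ofHom (awayEval ev hus)) ≫ Proj.awayι 𝒜 s hs hm) x ∈
      Proj.basicOpen 𝒜 t) : IsUnit (ev t) := by
  have h : Spec.map (CommRingCat.ofHom (awayEval ev hus)) x ∈
      Proj.awayι 𝒜 s hs hm ⁻¹ᵁ Proj.basicOpen 𝒜 t := hx
  rw [Proj.awayι_preimage_basicOpen 𝒜 hs hm ht hn] at h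
  by_contra ht0
  rw [isUnit_iff_ne_zero, not_not] at ht0
  refine h ?_
  have : awayEval ev hus (Away.isLocalizationElem hs ht) = 0 := by
    rw [Away.isLocalizationElem, awayEval_mk, map_pow, ht0, zero_pow hm.ne', zero_div]
  change awayEval ev hus (Away.isLocalizationElem hs ht) ∈ x.asIdeal
  rw [this]
  exact zero_mem _

lemma isIntegral_proj [IsDomain A] {s : A} (hs : s ≠ 0) {m : ℕ} (hm : 0 < m) (hsm : s ∈ 𝒜 m) :
    IsIntegral (Proj 𝒜) := by
  -- The zero ideal is a generic point; it is not excluded as irrelevant because `s` is nonzero of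
  -- positive degree.
  let x₀ : ProjectiveSpectrum 𝒜 := ⟨⊥, Ideal.isPrime_bot, fun h ↦ hs (by
    have h' := (HomogeneousIdeal.toIdeal_irrelevant_le _).mp h m hm hsm
    exact h')⟩
  have hirr : IrreducibleSpace (Proj 𝒜) := by
    have h : closure {(x₀ : Proj 𝒜)} = Set.univ := by
      refine Set.eq_univ_of_forall fun x ↦ mem_closure_iff.mpr fun U hU hxU ↦ ?_
      obtain ⟨_, ⟨f, rfl⟩, hf, hfU⟩ :=
        (ProjectiveSpectrum.isTopologicalBasis_basic_opens 𝒜).exists_subset_of_mem_open hxU hU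
      refine ⟨x₀, hfU ?_, rfl⟩
      intro h0
      have : f = 0 := h0
      exact hf (this ▸ zero_mem _)
    have := isIrreducible_singleton (x := (x₀ : Proj 𝒜)).closure
    rw [h] at this
    exact (irreducibleSpace_def _).mpr this
  have hred : IsReduced (Proj 𝒜) := by
    have hi (i : (Proj.affineOpenCover 𝒜).openCover.I₀) :
        IsReduced ((Proj.affineOpenCover 𝒜).openCover.X i) := by
      have : _root_.IsReduced (Away 𝒜 (i.2 : A)) :=
        isReduced_of_injective (algebraMap _ (Localization.Away (i.2 : A)))
          (HomogeneousLocalization.val_injective _)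
      exact inferInstanceAs (IsReduced (Spec (.of (Away 𝒜 (i.2 : A)))))
    exact IsReduced.of_openCover _ (Proj.affineOpenCover 𝒜).openCover
  exact isIntegral_of_irreducibleSpace_of_isReduced _

end AwayEval

/-! ### Standard charts of projective space -/

section Charts

open HomogeneousLocalization

variable {k : Type u} [Field k]

lemma eval₂_mul_pow_of_mem {n : ℕ} {w : Fin n → ℕ} (hw : ∀ i, w i = 1) {S : Type*} [CommRing S]
    (f : k →+* S) (r : Fin n → S) (x : S) {d : ℕ} {a : MvPolynomial (Fin n) k}
    (ha : a ∈ weightedHomogeneousSubmodule k w d) :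
    eval₂ f r a * x ^ d = eval₂ f (fun j ↦ r j * x) a := by
  rw [eval₂_eq', eval₂_eq', Finset.sum_mul]
  refine Finset.sum_congr rfl fun e he ↦ ?_
  have hd := ha (mem_support_iff.mp he)
  rw [Finsupp.weight_apply, Finsupp.sum_fintype _ _ (by simp)] at hd
  simp only [hw, smul_eq_mul, mul_one] at hd
  rw [← hd, ← Finset.prod_pow_eq_pow_sum, mul_assoc, ← Finset.prod_mul_distrib]
  simp only [mul_pow]

variable {n : ℕ} {w : Fin n → ℕ} (hw : ∀ i, w i = 1)

include hw in
lemma X_mem (i : Fin n) : (X i : MvPolynomial (Fin n) k) ∈ weightedHomogeneousSubmodule k w 1 :=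
  hw i ▸ isWeightedHomogeneous_X k w i

/-- The function `xⱼ / xᵢ` on the chart `D₊(xᵢ)`. -/
def ratio (i j : Fin n) : Away (weightedHomogeneousSubmodule k w) (X i) :=
  Away.mk _ (X_mem hw i) 1 (X j) (by rw [one_smul]; exact X_mem hw j)

lemma ratio_self (i : Fin n) : ratio (k := k) hw i i = 1 := by
  ext
  rw [ratio, Away.val_mk, val_one, Localization.mk_eq_mk']
  simp

/-- Dehomogenization, checked in the localization after multiplying by `xᵢᵈ`. -/
lemma awayMk_eq_eval₂ (i : Fin n) {d : ℕ} {a : MvPolynomial (Fin n) k}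
    (ha : a ∈ weightedHomogeneousSubmodule k w (d • 1)) :
    Away.mk _ (X_mem hw i) d a ha = eval₂ (awayConst w (X i)) (ratio hw i) a := by
  let L := Localization.Away (X i : MvPolynomial (Fin n) k)
  have hx : IsUnit (algebraMap (MvPolynomial (Fin n) k) L (X i)) :=
    IsLocalization.Away.algebraMap_isUnit _
  have hr (b : MvPolynomial (Fin n) k) (e : ℕ)
      (hb : b ∈ weightedHomogeneousSubmodule k w (e • 1)) :
      algebraMap (Away (weightedHomogeneousSubmodule k w) (X i)) L (Away.mk _ (X_mem hw i) e b hb) *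
        algebraMap (MvPolynomial (Fin n) k) L (X i) ^ e =
          algebraMap (MvPolynomial (Fin n) k) L b := by
    rw [HomogeneousLocalization.algebraMap_apply, Away.val_mk, Localization.mk_eq_mk', ← map_pow]
    exact IsLocalization.mk'_spec (M := Submonoid.powers (X i)) L b ⟨X i ^ e, e, rfl⟩
  apply HomogeneousLocalization.val_injective
  refine (hx.pow d).mul_right_cancel ((hr a d ha).trans ?_)
  have h := hom_eval₂ a (awayConst w (X i))
    (algebraMap (Away (weightedHomogeneousSubmodule k w) (X i)) L) (ratio hw i)
  rw [HomogeneousLocalization.algebraMap_apply] at h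
  rw [h, eval₂_mul_pow_of_mem hw _ _ _ (by simpa using ha)]
  have h₁ : (fun j ↦
      algebraMap (Away (weightedHomogeneousSubmodule k w) (X i)) L (ratio (k := k) hw i j) *
      algebraMap (MvPolynomial (Fin n) k) L (X i)) =
        fun j ↦ algebraMap (MvPolynomial (Fin n) k) L (X j) := by
    ext j
    have := hr (X j) 1 (by rw [one_smul]; exact X_mem hw j)
    rwa [pow_one] at this
  have h₂ : (algebraMap (Away (weightedHomogeneousSubmodule k w) (X i)) L).comp
      (awayConst w (X i)) = (algebraMap (MvPolynomial (Fin n) k) L).comp C := rfl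
  rw [h₁, h₂, ← hom_eval₂, eval₂_eta]

lemma awayEval_awayConst {R : Type u} [CommRing R] (w : Fin n → ℕ) {s : MvPolynomial (Fin n) k}
    (ev : MvPolynomial (Fin n) k →+* R) (hs : IsUnit (ev s)) (a : k) :
    awayEval ev hs (awayConst w s a) = ev (C a) :=
  IsLocalization.Away.lift_eq (S := Localization.Away s) s hs (C a)

lemma awayEval_ratio {R : Type u} [CommRing R] {i : Fin n} (j : Fin n)
    (ev : MvPolynomial (Fin n) k →+* R) (hs : IsUnit (ev (X i))) :
    awayEval ev hs (ratio hw i j) * ev (X i) = ev (X j) := by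
  have h := awayEval_mk_mul ev hs (X_mem hw i) 1 (a := X j)
    (by rw [one_smul]; exact X_mem hw j)
  rwa [pow_one] at h

/-- A point of the chart has homogeneous coordinates normalized by `xᵢ = 1`. -/
lemma eq_awayEval {R : Type u} [CommRing R] (i : Fin n)
    (ψ : Away (weightedHomogeneousSubmodule k w) (X i) →+* R)
    (hu : IsUnit (eval₂Hom (ψ.comp (awayConst w (X i))) (fun j ↦ ψ (ratio hw i j)) (X i))) :
    ψ = awayEval (eval₂Hom (ψ.comp (awayConst w (X i))) fun j ↦ ψ (ratio hw i j)) hu := by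
  refine eq_awayEval_of_forall_mk _ _ (X_mem hw i) _ fun d a ha ↦ ?_
  rw [awayMk_eq_eval₂, hom_eval₂, coe_eval₂Hom, eval₂_X, ratio_self, map_one, one_pow, mul_one]

end Charts

/-! ### Coordinate rings of the charts of `ℙ¹` -/

section ProjectiveLine

open HomogeneousLocalization

variable {k : Type u} [Field k]

lemma weights_two (i : Fin 2) : (![1, 1] : Fin 2 → ℕ) i = 1 := by
  fin_cases i <;> rfl

lemma weights_three (i : Fin 3) : (![1, 1, 1] : Fin 3 → ℕ) i = 1 := by
  fin_cases i <;> rfl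

variable (k) in
/-- The coordinate ring of a standard chart of `ℙ¹`. -/
def polyToAway (i j : Fin 2) :
    Polynomial k →+* Away (weightedHomogeneousSubmodule k ![1, 1]) (X i) :=
  Polynomial.eval₂RingHom (awayConst ![1, 1] (X i)) (ratio weights_two i j)

lemma polyToAway_bijective {i j : Fin 2} (hij : i ≠ j) : Function.Bijective (polyToAway k i j) := by
  have hj (l : Fin 2) : l = i ∨ l = j := by omega
  constructor
  -- The inverse sets `xᵢ = 1` and `xⱼ = t`.
  · let v : Fin 2 → Polynomial k := fun l ↦ if l = i then 1 else Polynomial.X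
    have hu : IsUnit (eval₂Hom (Polynomial.C : k →+* _) v (X i)) := by simp [v]
    have : (awayEval (𝒜 := weightedHomogeneousSubmodule k ![1, 1]) _ hu).comp (polyToAway k i j) =
        RingHom.id _ := by
      refine Polynomial.ringHom_ext (fun a ↦ ?_) ?_
      · simp [polyToAway, awayEval_awayConst]
      · have := awayEval_ratio weights_two j _ hu
        simpa [polyToAway, v, hij.symm] using this
    exact Function.LeftInverse.injective (g := awayEval _ hu) fun x ↦ congr($this x)
  · intro x
    obtain ⟨n, a, ha, rfl⟩ := Away.mk_surjective _ (X_mem weights_two i) x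
    rw [awayMk_eq_eval₂ weights_two]
    refine ⟨eval₂ Polynomial.C (fun l ↦ if l = i then 1 else Polynomial.X) a, ?_⟩
    rw [hom_eval₂]
    congr 1
    · ext a
      simp [polyToAway]
    · ext l
      rcases hj l with rfl | rfl
      · simp [ratio_self]
      · simp [polyToAway, hij.symm]

instance : IsIntegral (WProj k ![1, 1]) :=
  isIntegral_proj (X_ne_zero 0) one_pos (X_mem weights_two 0)

end ProjectiveLine

/-! ### Affine charts and the function field -/

section AffineChart

lemma exists_ringEquiv_of_isOpenImmersion {R : Type u} [CommRing R] {P : Scheme.{u}}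
    (j : Spec (.of R) ⟶ P) [IsOpenImmersion j] :
    ∃ e : R ≃+* Γ(P, j.opensRange), (isAffineOpen_opensRange j).fromSpec =
      Spec.map (CommRingCat.ofHom (e : R →+* Γ(P, j.opensRange))) ≫ j := by
  have h : Set.range (isAffineOpen_opensRange j).fromSpec = Set.range j := by
    rw [IsAffineOpen.range_fromSpec]
    rfl
  let e := IsOpenImmersion.isoOfRangeEq _ _ h
  obtain ⟨φ, hφ⟩ := Spec.map_surjective e.hom
  obtain ⟨ψ, hψ⟩ := Spec.map_surjective e.inv
  let i : CommRingCat.of R ≅ Γ(P, j.opensRange) :=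
    ⟨φ, ψ, Spec.map_injective (by rw [Spec.map_comp, hφ, hψ, e.inv_hom_id, Spec.map_id]),
      Spec.map_injective (by rw [Spec.map_comp, hφ, hψ, e.hom_inv_id, Spec.map_id])⟩
  refine ⟨i.commRingCatIsoToRingEquiv, ?_⟩
  rw [← IsOpenImmersion.isoOfRangeEq_hom_fac _ _ h]
  exact congrArg (· ≫ j) hφ.symm

/-- Applied to a chart `Spec k[t]` of `ℙ¹`, this lets the function field play the role of `k(t)` in
the `p`-th power criterion. -/
lemma exists_isFractionRing_functionField {R : Type u} [CommRing R] [Nontrivial R] {P : Scheme.{u}}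
    [IsIntegral P] (j : Spec (.of R) ⟶ P) [IsOpenImmersion j] :
    ∃ γ : R →+* P.functionField,
      Spec.map (CommRingCat.ofHom γ) ≫ j = P.fromSpecStalk (genericPoint P) ∧
        (letI := γ.toAlgebra; IsFractionRing R P.functionField) := by
  obtain ⟨e, he⟩ := exists_ringEquiv_of_isOpenImmersion j
  have hU : IsAffineOpen j.opensRange := isAffineOpen_opensRange j
  have hne : Nonempty (Spec (.of R)) := inferInstanceAs (Nonempty (PrimeSpectrum R))
  have hne' : Nonempty j.opensRange := ⟨⟨j hne.some, hne.some, rfl⟩⟩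
  have hη : genericPoint P ∈ j.opensRange :=
    ((genericPoint_spec P).mem_open_set_iff j.opensRange.isOpen).mpr (by
      simpa using ⟨_, hne'.some.2⟩)
  let γ : R →+* P.functionField :=
    (P.germToFunctionField j.opensRange).hom.comp (e : R →+* Γ(P, j.opensRange))
  refine ⟨γ, ?_, ?_⟩
  · rw [← hU.fromSpecStalk_eq_fromSpecStalk hη, IsAffineOpen.fromSpecStalk, he,
      ← Category.assoc, ← Spec.map_comp]
    rfl
  · have := functionField_isFractionRing_of_isAffineOpen P j.opensRange hU
    exact (IsFractionRing.isFractionRing_iff_of_base_ringEquiv _ e.symm).mp this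

end AffineChart

/-! ### The projective line -/

section ProjectiveLine

open HomogeneousLocalization

variable {k : Type u} [Field k]

variable (k) in
/-- The coordinate ring of the chart `D₊(xᵢ)` of `ℙ¹` is a polynomial ring in `xⱼ / xᵢ`. -/
def polyEquivAway {i j : Fin 2} (hij : i ≠ j) :
    Polynomial k ≃+* Away (weightedHomogeneousSubmodule k ![1, 1]) (X i) :=
  RingEquiv.ofBijective (polyToAway k i j) (polyToAway_bijective hij)

variable (k) in
/-- The chart `D₊(xᵢ) = Spec k[t]` of `ℙ¹`, where `t = xⱼ / xᵢ`. -/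
def lineChart {i j : Fin 2} (hij : i ≠ j) : Spec (.of (Polynomial k)) ⟶ WProj k ![1, 1] :=
  Spec.map (CommRingCat.ofHom (polyEquivAway k hij).symm.toRingHom) ≫
    Proj.awayι _ (X i) (X_mem weights_two i) one_pos

instance {i j : Fin 2} (hij : i ≠ j) : IsOpenImmersion (lineChart k hij) := by
  have : IsIso (CommRingCat.ofHom (polyEquivAway k hij).symm.toRingHom) :=
    (polyEquivAway k hij).symm.toCommRingCatIso.isIso_hom
  rw [lineChart]
  infer_instance

lemma opensRange_lineChart {i j : Fin 2} (hij : i ≠ j) :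
    (lineChart k hij).opensRange =
      Proj.basicOpen (weightedHomogeneousSubmodule k ![1, 1]) (X i) := by
  have : IsIso (CommRingCat.ofHom (polyEquivAway k hij).symm.toRingHom) :=
    (polyEquivAway k hij).symm.toCommRingCatIso.isIso_hom
  rw [← Proj.opensRange_awayι _ (X i) (X_mem weights_two i) one_pos]
  exact Scheme.Hom.opensRange_comp_of_isIso _ _

lemma lineChart_toSpec {i j : Fin 2} (hij : i ≠ j) :
    lineChart k hij ≫ WProj.toSpec k ![1, 1] = Spec.map (CommRingCat.ofHom Polynomial.C) := by
  rw [lineChart, Category.assoc, awayι_toSpec, ← Spec.map_comp, ← CommRingCat.ofHom_comp]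
  congr 2
  refine RingHom.ext fun a ↦ ?_
  exact (polyEquivAway k hij).symm_apply_eq.mpr (Polynomial.eval₂_C _ _).symm

lemma iSup_basicOpen_X {n : ℕ} (w : Fin n → ℕ) :
    ⨆ i, Proj.basicOpen (weightedHomogeneousSubmodule k w) (X i) = ⊤ := by
  refine Proj.iSup_basicOpen_eq_top' _ _ (fun i ↦ ⟨w i, isWeightedHomogeneous_X k w i⟩)
    (eq_top_iff.mpr fun a _ ↦ ?_)
  induction a using MvPolynomial.induction_on with
  | C a =>
    let b : weightedHomogeneousSubmodule k w 0 := ⟨C a, isWeightedHomogeneous_C w a⟩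
    exact Subalgebra.algebraMap_mem (Algebra.adjoin _ (Set.range X)) b
  | add a b ha hb => exact add_mem (ha trivial) (hb trivial)
  | mul_X a i ha => exact mul_mem (ha trivial) (Algebra.subset_adjoin ⟨i, rfl⟩)

lemma isIntegrallyClosed_lineChart {i j : Fin 2} (hij : i ≠ j) :
    IsIntegrallyClosed Γ(WProj k ![1, 1], (lineChart k hij).opensRange) := by
  obtain ⟨e, -⟩ := exists_ringEquiv_of_isOpenImmersion (lineChart k hij)
  exact IsIntegrallyClosed.of_equiv e

/-- The point `[1 : 0]`. Its existence forces the image of an `𝔸¹`-curve to meet the boundary. -/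
lemma exists_mem_zeros : ∃ x : WProj k ![1, 1], x ∈ WProj.zeros k ![1, 1] (X 1) := by
  let ev : MvPolynomial (Fin 2) k →+* k := eval₂Hom (RingHom.id k) ![1, 0]
  have hu : IsUnit (ev (X 0)) := by simp [ev]
  let x : Spec (.of k) := (⊥ : PrimeSpectrum k)
  refine ⟨(Spec.map (CommRingCat.ofHom (awayEval ev hu)) ≫
    Proj.awayι (weightedHomogeneousSubmodule k ![1, 1]) (X 0) (X_mem weights_two 0) one_pos) x, ?_⟩
  rw [mem_zeros_iff]
  intro h
  have := isUnit_of_awayEval_mem_basicOpen one_pos one_pos _ (X_mem weights_two 1) hu x h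
  simp [ev] at this

/-- A morphism from `ℙ¹` lifts along an integral morphism if it does so at the generic point. -/
lemma exists_lift_of_functionField {X Z : Scheme.{u}} (F : Z ⟶ X) [IsIntegralHom F]
    (f : WProj k ![1, 1] ⟶ X) (z : Spec (WProj k ![1, 1]).functionField ⟶ Z)
    (hz : z ≫ F = (WProj k ![1, 1]).fromSpecStalk (genericPoint _) ≫ f) :
    ∃ g : WProj k ![1, 1] ⟶ Z, g ≫ F = f := by
  have hne (i : Fin 2) : i ≠ i + 1 := by omega
  refine exists_lift_of_isIntegralHom (WProj k ![1, 1])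
    (fun i : Fin 2 ↦ ⟨(lineChart k (hne i)).opensRange, isAffineOpen_opensRange _⟩) ?_ ?_ ?_
    F f z hz
  · simp only [opensRange_lineChart]
    exact iSup_basicOpen_X _
  · intro i
    exact ⟨⟨lineChart k (hne i) (⊥ : PrimeSpectrum (Polynomial k)), _, rfl⟩⟩
  · intro i
    exact isIntegrallyClosed_lineChart (hne i)

end ProjectiveLine

/-! ### Existence and uniqueness of lifts -/

section Lift

open HomogeneousLocalization

variable {k : Type u} [Field k]

lemma eval₂_sigma (p : ℕ) (c : ℕ → k) {K : Type*} [CommRing K] (ι : k →+* K) (v : Fin 3 → K) :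
    eval₂Hom ι v (sigma p c) =
      ∑ i ∈ Finset.Icc 1 (p - 1), ι (c i) * v 0 ^ i * v 1 ^ (p - i) := by
  simp [sigma]

/-- `Δ_X` avoids `[0 : 0 : 1]`: modulo `x₀` its equation is `-x₂ᵖ`. -/
lemma exists_mem_basicOpen_X (p : ℕ) (c : ℕ → k) (x : WProj k ![1, 1, 1])
    (hx : x ∈ WProj.zeros k ![1, 1, 1] (sigma p c - X 2 ^ p)) :
    ∃ i : Fin 3, (i = 0 ∨ i = 1) ∧
      x ∈ Proj.basicOpen (weightedHomogeneousSubmodule k ![1, 1, 1]) (X i) := by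
  have hP : x.asHomogeneousIdeal.toIdeal.IsPrime := x.isPrime
  have hq : sigma p c - X 2 ^ p ∈ x.asHomogeneousIdeal.toIdeal := Set.singleton_subset_iff.mp hx
  have hcov : x ∈ ⨆ i, Proj.basicOpen (weightedHomogeneousSubmodule k ![1, 1, 1]) (X i) := by
    rw [iSup_basicOpen_X]; trivial
  obtain ⟨i, hi⟩ := TopologicalSpace.Opens.mem_iSup.mp hcov
  by_contra! H
  have h0 : X 0 ∈ x.asHomogeneousIdeal.toIdeal := not_not.mp (H 0 (Or.inl rfl))
  have h1 : X 1 ∈ x.asHomogeneousIdeal.toIdeal := not_not.mp (H 1 (Or.inr rfl))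
  fin_cases i
  · exact hi h0
  · exact hi h1
  · refine hi (hP.mem_of_pow_mem p ?_)
    have hs : sigma p c ∈ x.asHomogeneousIdeal.toIdeal := by
      rw [sigma]
      refine sum_mem fun i hi ↦ ?_
      apply Ideal.mul_mem_right
      apply Ideal.mul_mem_left
      exact Ideal.pow_mem_of_mem _ h0 _ (Finset.mem_Icc.mp hi).1
    have := Ideal.sub_mem _ hs hq
    rwa [sub_sub_cancel] at this

variable (p : ℕ) [Fact p.Prime] [CharP k p] (c : ℕ → k)

lemma exists_pow_eq_of_chart [IsAlgClosed k] (hc₁ : c 1 = 1) (hc₂ : c (p - 1) = 1)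
    {K : Type u} [Field K] [Algebra (Polynomial k) K] [IsFractionRing (Polynomial k) K]
    {ι : k →+* K} (hι : ι = (algebraMap (Polynomial k) K).comp Polynomial.C)
    (v : Fin 3 → K) {i : Fin 3} (hi : i = 0 ∨ i = 1) (hvi : v i = 1)
    (hq : eval₂Hom ι v (sigma p c - X 2 ^ p) ≠ 0)
    (h : ∀ a ∈ weightedHomogeneousSubmodule k ![1, 1, 1] p, ∃ r,
      algebraMap (Polynomial k) K r = eval₂Hom ι v a / eval₂Hom ι v (sigma p c - X 2 ^ p))
    {l : Fin 3} (hl : l = 0 ∨ l = 1) : ∃ α, α ^ p = v l := by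
  subst hι
  have hX (j : Fin 3) : (X j ^ p : MvPolynomial (Fin 3) k) ∈
      weightedHomogeneousSubmodule k ![1, 1, 1] p := by
    have := (isWeightedHomogeneous_X k ![1, 1, 1] j).pow p
    rwa [weights_three, smul_eq_mul, mul_one] at this
  -- `r j` is the polynomial `xⱼᵖ / q`; thus `r i` serves as `g` in the criterion, as `v i = 1`.
  choose r hr using fun j ↦ h _ (hX j)
  have hp : 1 ≤ p := (Nat.Prime.pos Fact.out)
  set Q := eval₂Hom ((algebraMap (Polynomial k) K).comp Polynomial.C) v (sigma p c - X 2 ^ p)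
    with hQ
  have hr' (j) : algebraMap (Polynomial k) K (r j) =
      algebraMap (Polynomial k) K (r i) * v j ^ p := by
    rw [hr, hr]
    simp [hvi, div_eq_inv_mul]
  have hri : algebraMap (Polynomial k) K (r i) * Q = 1 := by
    rw [hr, div_mul_cancel₀ _ hq]
    simp [hvi]
  rw [map_sub, eval₂_sigma] at hQ
  rcases eq_or_ne l i with rfl | hli
  · exact ⟨1, by rw [hvi, one_pow]⟩
  rcases hi with rfl | rfl
  · obtain rfl : l = 1 := by tauto
    -- With `x₀ = 1` the form `σ` is a polynomial in `x₁` with the coefficients in reverse order, so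
    -- its linear coefficient is `c (p - 1)`.
    refine exists_pow_eq_of_mul_sub_pow_eq_one (p := p) (c := fun j ↦ c (p - j)) hc₂ (hr' 1)
      (hr' 2) ?_
    rw [← hri, hQ]
    congr 2
    · simp only [hvi, one_pow, mul_one]
      refine Finset.sum_nbij' (fun j ↦ p - j) (fun j ↦ p - j) ?_ ?_ ?_ ?_ ?_
      all_goals intro j hj; rw [Finset.mem_Icc] at hj
      · rw [Finset.mem_Icc]; omega
      · rw [Finset.mem_Icc]; omega
      · omega
      · omega
      · rw [show p - (p - j) = j by omega]; rfl
    · simp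
  · obtain rfl : l = 0 := by tauto
    refine exists_pow_eq_of_mul_sub_pow_eq_one (p := p) (c := c) hc₁ (hr' 0) (hr' 2) ?_
    rw [← hri, hQ]
    simp [hvi]

variable [PerfectRing k p]

/-- Solves `F(z) = v` coordinatewise: `z₀ = α`, `z₁ = β`, `z₂ = σ^{1/p}(α, β) - v₂`. -/
lemma exists_point_lift {K : Type u} [Field K] (ι : k →+* K) (v : Fin 3 → K)
    {α β : K} (hα : α ^ p = v 0) (hβ : β ^ p = v 1) {m : ℕ} (hm : 0 < m)
    {s : MvPolynomial (Fin 3) k} (hs : s ∈ weightedHomogeneousSubmodule k ![1, 1, 1] m)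
    (hu : IsUnit (eval₂Hom ι v s)) :
    ∃ z : Spec (.of K) ⟶ (pairZ k p).space, z ≫ mapZX p c =
      Spec.map (CommRingCat.ofHom (awayEval (eval₂Hom ι v) hu)) ≫ Proj.awayι _ s hs hm := by
  -- The last coordinate `0` is arbitrary, since `σ^{1/p}` does not involve `x₂`.
  let γ : K := eval₂Hom ι ![α, β, 0] (sigmaRoot p c)
  let ev : MvPolynomial (Fin 3) k →+* K := eval₂Hom ι ![α, β, γ - v 2]
  have hev (a : MvPolynomial (Fin 3) k) : ev (substZX p c a) = eval₂Hom ι v a := by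
    have : ev.comp (substZX p c : MvPolynomial (Fin 3) k →+* MvPolynomial (Fin 3) k) =
        eval₂Hom ι v := by
      refine MvPolynomial.ringHom_ext (fun a ↦ ?_) fun j ↦ ?_
      · simp [ev, substZX]
      · fin_cases j
        · simpa [ev, substZX] using hα
        · simpa [ev, substZX] using hβ
        · simp [ev, substZX, γ, sigmaRoot, sigma]
    exact congr($this a)
  have hu' : IsUnit (ev (substZX p c s)) := by rwa [hev]
  have hp : 0 < p := Nat.Prime.pos Fact.out
  refine ⟨Spec.map (CommRingCat.ofHom (awayEval ev hu')) ≫ Proj.awayι _ (substZX p c s)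
    (substZX_mem p c _ _ hs) (Nat.mul_pos hp hm), ?_⟩
  refine (Category.assoc _ _ _).trans ((congrArg _ (awayι_mapZX p c hm hs)).trans ?_)
  have h : (awayEval ev hu').comp (awayZX p c s) = awayEval (eval₂Hom ι v) hu := by
    refine eq_awayEval_of_forall_mk _ hu hs _ fun n a ha ↦ ?_
    rw [← hev, ← hev]
    refine Eq.trans ?_ (awayEval_mk_mul ev hu' (substZX_mem p c _ _ hs) n (a := substZX p c a)
      (by have := substZX_mem p c _ _ ha; rwa [smul_eq_mul, mul_left_comm] at this))
    exact congrArg (fun y ↦ awayEval ev hu' y * ev (substZX p c s) ^ n) (awayZX_mk p c hs n a ha)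
  exact (Category.assoc _ _ _).symm.trans (congrArg (· ≫ Proj.awayι _ s hs hm)
    ((Spec.map_comp _ _).symm.trans (congrArg (fun φ ↦ Spec.map (CommRingCat.ofHom φ)) h)))

lemma exists_lift [IsAlgClosed k] (hc₁ : c 1 = 1) (hc₂ : c (p - 1) = 1)
    (f : A1Curve (pairX p c)) :
    ∃ g : (P1Infty k).space ⟶ (pairZ k p).space, g ≫ mapZX p c = f.hom := by
  have := isIntegralHom_mapZX p c
  let P := WProj k ![1, 1]
  let 𝒜 := weightedHomogeneousSubmodule k ![1, 1, 1]
  let q : MvPolynomial (Fin 3) k := sigma p c - X 2 ^ p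
  have hp : 0 < p := Nat.Prime.pos Fact.out
  have hq : q ∈ 𝒜 p := sigma_sub_mem p c
  let F : P ⟶ Proj 𝒜 := f.hom
  have hFq : F ⁻¹ᵁ Proj.basicOpen 𝒜 q =
      Proj.basicOpen (weightedHomogeneousSubmodule k ![1, 1]) (X 1) := by
    ext x
    have hx := Set.ext_iff.mp f.preimage_boundary x
    exact not_iff_not.mp ((mem_zeros_iff _ _ (F x)).symm.trans (hx.trans (mem_zeros_iff _ _ x)))
  obtain ⟨γ, hγ, hfr⟩ := exists_isFractionRing_functionField (lineChart k one_ne_zero)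
  let K := P.functionField
  let : Algebra (Polynomial k) K := γ.toAlgebra
  have : IsFractionRing (Polynomial k) K := hfr
  let x : Spec (.of K) ⟶ Proj 𝒜 := P.fromSpecStalk (genericPoint P) ≫ F
  have hxpt (y : Spec (.of K)) : x y = F (genericPoint P) := by
    have hsub : Subsingleton (Spec (.of K)) := inferInstanceAs (Subsingleton (PrimeSpectrum K))
    rw [Subsingleton.elim y (IsLocalRing.closedPoint K)]
    exact congrArg F (Scheme.fromSpecStalk_closedPoint (X := P))
  have hgen (s : MvPolynomial (Fin 3) k) (y : P) (hy : F y ∈ Proj.basicOpen 𝒜 s)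
      (y' : Spec (.of K)) : x y' ∈ Proj.basicOpen 𝒜 s := by
    rw [hxpt]
    exact ((genericPoint_spec P).mem_open_set_iff (F ⁻¹ᵁ Proj.basicOpen 𝒜 s).isOpen).mpr
      (by simpa using ⟨y, hy⟩)
  -- A point over `∞` lands on `Δ_X`, hence in `D₊(x₀)` or `D₊(x₁)`; the generic point then lands
  -- there too.
  obtain ⟨i, hi, hxi⟩ : ∃ i : Fin 3, (i = 0 ∨ i = 1) ∧ ∀ y, x y ∈ Proj.basicOpen 𝒜 (X i) := by
    obtain ⟨y, hy⟩ := exists_mem_zeros (k := k)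
    have hFy : F y ∈ WProj.zeros k ![1, 1, 1] (sigma p c - X 2 ^ p) :=
      (Set.ext_iff.mp f.preimage_boundary y).mpr hy
    obtain ⟨i, hi, h⟩ := exists_mem_basicOpen_X p c (F y) hFy
    exact ⟨i, hi, hgen _ y h⟩
  -- The chart `D₊(x₁)` of `ℙ¹` is the complement of `∞`, so it maps into the affine open set
  -- `D₊(q)`.
  have hchart (y) : (lineChart k one_ne_zero ≫ F) y ∈ Proj.basicOpen 𝒜 q := by
    have : lineChart k one_ne_zero y ∈ F ⁻¹ᵁ Proj.basicOpen 𝒜 q := by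
      rw [hFq, ← opensRange_lineChart one_ne_zero]
      exact ⟨y, rfl⟩
    exact this
  have hxq (y) : x y ∈ Proj.basicOpen 𝒜 q := hgen q _ (hchart (⊥ : PrimeSpectrum _)) y
  have hx : x = Spec.map (CommRingCat.ofHom γ) ≫ lineChart k one_ne_zero ≫ F := by
    rw [← Category.assoc, hγ]
  obtain ⟨ψ, hψ⟩ := exists_awayι_of_mem_basicOpen one_pos (X_mem weights_three i) x hxi
  obtain ⟨θ, hθ⟩ := exists_awayι_of_mem_basicOpen hp hq (lineChart k one_ne_zero ≫ F) hchart
  let ι : k →+* K := ψ.comp (awayConst ![1, 1, 1] (X i))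
  -- `f` is a morphism over `k`, so the constants act on `K` in the standard way.
  have hι : ι = γ.comp Polynomial.C := by
    have h₁ : x ≫ WProj.toSpec k ![1, 1, 1] = Spec.map (CommRingCat.ofHom ι) := by
      rw [hψ, Category.assoc, awayι_toSpec, ← Spec.map_comp, ← CommRingCat.ofHom_comp]
    have h₂ : x ≫ WProj.toSpec k ![1, 1, 1] =
        Spec.map (CommRingCat.ofHom (γ.comp Polynomial.C)) := by
      have h₃ : F ≫ WProj.toSpec k ![1, 1, 1] = WProj.toSpec k ![1, 1] := f.hom_toSpec
      rw [hx, Category.assoc, Category.assoc, h₃, lineChart_toSpec, ← Spec.map_comp,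
        ← CommRingCat.ofHom_comp]
    exact congrArg CommRingCat.Hom.hom (Spec.map_injective (h₁.symm.trans h₂))
  let v : Fin 3 → K := fun j ↦ ψ (ratio weights_three i j)
  have hvi : v i = 1 := by simp [v, ratio_self]
  have hu : IsUnit (eval₂Hom ι v (X i)) := by simp [hvi]
  have hψ' : ψ = awayEval (eval₂Hom ι v) hu := eq_awayEval weights_three i ψ hu
  have hxev : x = Spec.map (CommRingCat.ofHom (awayEval (eval₂Hom ι v) hu)) ≫
      Proj.awayι _ (X i) (X_mem weights_three i) one_pos := by rw [← hψ', hψ]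
  have huq : IsUnit (eval₂Hom ι v q) := by
    refine isUnit_of_awayEval_mem_basicOpen one_pos hp (X_mem weights_three i) hq hu
      (⊥ : PrimeSpectrum K) ?_
    rw [← hxev]
    exact hxq _
  -- The charts `D₊(xᵢ)` and `D₊(q)` see the same generic point. Hence `a(v) / q(v)` is the image of
  -- the polynomial `θ(a / q)` for each form `a` of degree `p`.
  have hθ' : γ.comp θ = awayEval (eval₂Hom ι v) huq := by
    suffices h : Spec.map (CommRingCat.ofHom (γ.comp θ)) =
        Spec.map (CommRingCat.ofHom (awayEval (eval₂Hom ι v) huq)) from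
      congrArg CommRingCat.Hom.hom (Spec.map_injective h)
    rw [← cancel_mono (Proj.awayι _ q hq hp),
      ← awayEval_awayι one_pos hp (X_mem weights_three i) hq hu huq,
      ← hxev, hx, hθ, ← Category.assoc, CommRingCat.ofHom_comp, Spec.map_comp]
  have hroot (l : Fin 3) (hl : l = 0 ∨ l = 1) : ∃ α, α ^ p = v l := by
    refine exists_pow_eq_of_chart p c hc₁ hc₂ hι v hi hvi huq.ne_zero (fun a ha ↦ ?_) hl
    refine ⟨θ (Away.mk _ hq 1 a (by rwa [one_smul])), ?_⟩
    have h := awayEval_mk (eval₂Hom ι v) huq hq 1 (a := a) (by rwa [one_smul])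
    rw [pow_one, ← hθ'] at h
    exact h
  obtain ⟨α, hα⟩ := hroot 0 (Or.inl rfl)
  obtain ⟨β, hβ⟩ := hroot 1 (Or.inr rfl)
  obtain ⟨z, hz⟩ := exists_point_lift p c ι v hα hβ one_pos (X_mem weights_three i) hu
  refine exists_lift_of_functionField (mapZX p c) f.hom z ?_
  rw [hz, ← hψ']
  exact hψ.symm

end Lift

/-! ### Existence and uniqueness of lifted `𝔸¹`-curves -/

section Curves

variable {k : Type u} [Field k] (p : ℕ) [Fact p.Prime] [CharP k p] [PerfectRing k p] (c : ℕ → k)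

lemma exists_a1Curve_lift [IsAlgClosed k] (hc₁ : c 1 = 1) (hc₂ : c (p - 1) = 1)
    (f : A1Curve (pairX p c)) : ∃ g : A1Curve (pairZ k p), g.hom ≫ mapZX p c = f.hom := by
  obtain ⟨g, hg⟩ := exists_lift p c hc₁ hc₂ f
  have h₁ : g ≫ (pairZ k p).toSpec = (P1Infty k).toSpec := by
    rw [← mapZX_toSpec p c, ← Category.assoc, hg, f.hom_toSpec]
  have h₂ (x : (P1Infty k).space) : mapZX p c (g x) = f.hom x := by
    rw [← Scheme.Hom.comp_apply, hg]
  refine ⟨⟨g, h₁, Set.ext fun x ↦ ?_⟩, hg⟩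
  have h₃ := Set.ext_iff.mp (mapZX_preimage_boundary p c) (g x)
  rw [Set.mem_preimage, h₂] at h₃
  exact h₃.symm.trans (Set.ext_iff.mp f.preimage_boundary x)

/-- The lifts agree at the generic point by `mapZX_cancel`; this suffices because `ℙ¹` is reduced
and `F`, being integral, is separated. -/
lemma a1Curve_lift_unique {g g' : A1Curve (pairZ k p)}
    (h : g.hom ≫ mapZX p c = g'.hom ≫ mapZX p c) : g = g' := by
  suffices h' : g.hom = g'.hom by
    cases g; cases g'; subst h'; rfl
  have := isIntegralHom_mapZX p c
  obtain ⟨γ, -, -⟩ := exists_isFractionRing_functionField (lineChart k one_ne_zero)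
  have : CharP (WProj k ![1, 1]).functionField p :=
    charP_of_injective_ringHom (γ.comp Polynomial.C).injective p
  have : IsReduced (P1Infty k).space := inferInstanceAs (IsReduced (WProj k ![1, 1]))
  let η : Spec (.of (WProj k ![1, 1]).functionField) ⟶ (P1Infty k).space :=
    (WProj k ![1, 1]).fromSpecStalk (genericPoint _)
  have : IsDominant η := isDominant_fromSpecStalk_genericPoint (WProj k ![1, 1])
  exact ext_of_isDominant_of_isSeparated (mapZX p c) h η
    (mapZX_cancel p c (by rw [Category.assoc, Category.assoc, h]))

end Curves

/-! ### Boundary ideals on charts -/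

section ChartIdeal

open HomogeneousLocalization

variable {A : Type u} [CommRing A] {α : Type*} [SetLike α A] [AddSubgroupClass α A] {𝒜 : ℕ → α}
  [GradedRing 𝒜]

lemma idealSheaf_ext_of_awayι {I J : (Proj 𝒜).IdealSheafData}
    (h : ∀ x : Proj 𝒜, ∃ (m : ℕ) (hm : 0 < m) (s : A) (hs : s ∈ 𝒜 m),
      x ∈ Proj.basicOpen 𝒜 s ∧ I.comap (Proj.awayι 𝒜 s hs hm) = J.comap (Proj.awayι 𝒜 s hs hm)) :
    I = J := by
  choose m hm s hs hx h using h
  let 𝒰 : (Proj 𝒜).AffineOpenCover :=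
    { I₀ := Proj 𝒜
      X x := .of (Away 𝒜 (s x))
      f x := Proj.awayι 𝒜 (s x) (hs x) (hm x)
      idx x := x
      covers x := by
        change x ∈ (Proj.awayι 𝒜 _ _ _).opensRange
        rw [Proj.opensRange_awayι]
        exact hx x }
  exact idealSheaf_ext_of_openCover 𝒰.openCover fun x ↦ h x

variable {m e : ℕ} (hm : 0 < m) {s q : A} (hs : s ∈ 𝒜 m) (hq : q ∈ 𝒜 (e • m))

lemma awayι_mem_zeroLocus_iff (x : Spec (.of (Away 𝒜 s))) (he : 0 < e) :
    Proj.awayι 𝒜 s hs hm x ∈ ProjectiveSpectrum.zeroLocus 𝒜 {q} ↔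
      Away.mk 𝒜 hs e q hq ∈ PrimeSpectrum.asIdeal x := by
  have h := SetLike.ext_iff.mp
    (Proj.awayι_preimage_basicOpen 𝒜 hs hm hq (Nat.mul_pos he hm : 0 < e • m)) x
  have h' : Away.isLocalizationElem hs hq = Away.mk 𝒜 hs e q hq ^ m := by
    rw [awayMk_pow]
    rfl
  rw [h', PrimeSpectrum.basicOpen_pow _ _ hm] at h
  have h₁ : Proj.awayι 𝒜 s hs hm x ∈ ProjectiveSpectrum.zeroLocus 𝒜 {q} ↔
      ¬ Proj.awayι 𝒜 s hs hm x ∈ Proj.basicOpen 𝒜 q :=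
    Set.singleton_subset_iff.trans not_not.symm
  rw [h₁]
  exact (not_congr h).trans not_not

/-- A function vanishing on `q = 0` vanishes at the generic point of this hypersurface, so `q`
divides its numerator. -/
lemma specIdeal_vanishingIdeal_eq_span (hqp : Prime q) (hqs : ¬ q ∣ s) (he : 0 < e)
    (Z : TopologicalSpace.Closeds (Proj 𝒜))
    (hZ : (Z : Set (Proj 𝒜)) = ProjectiveSpectrum.zeroLocus 𝒜 {q}) :
    specIdeal ((Scheme.IdealSheafData.vanishingIdeal Z).comap (Proj.awayι 𝒜 s hs hm)) =
      Ideal.span {Away.mk 𝒜 hs e q hq} := by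
  have hZ' (x : Spec (.of (Away 𝒜 s))) : Proj.awayι 𝒜 s hs hm x ∈ Z ↔
      Away.mk 𝒜 hs e q hq ∈ PrimeSpectrum.asIdeal x := by
    rw [← awayι_mem_zeroLocus_iff hm hs hq x he, ← hZ]
    rfl
  ext r
  rw [mem_specIdeal_comap_vanishingIdeal]
  refine ⟨fun h ↦ ?_, fun h x hx ↦ ?_⟩
  · have : (Ideal.span {q}).IsPrime := (Ideal.span_singleton_prime hqp.ne_zero).mpr hqp
    -- Evaluation in `Frac(A / q)` is the generic point of `q = 0`; it lies in the chart because `q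
    -- ∤ s`.
    let K := FractionRing (A ⧸ Ideal.span {q})
    let ev : A →+* K := (algebraMap (A ⧸ Ideal.span {q}) K).comp (Ideal.Quotient.mk _)
    have hev (a : A) : ev a = 0 ↔ q ∣ a := by
      rw [← Ideal.mem_span_singleton, ← Ideal.Quotient.eq_zero_iff_mem]
      exact FaithfulSMul.algebraMap_eq_zero_iff (A ⧸ Ideal.span {q}) K
    have hu : IsUnit (ev s) := isUnit_iff_ne_zero.mpr ((hev s).not.mpr hqs)
    let x : Spec (.of (Away 𝒜 s)) :=
      (⟨RingHom.ker (awayEval ev hu), RingHom.ker_isPrime _⟩ : PrimeSpectrum (Away 𝒜 s))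
    have hr := h x ((hZ' x).mpr (RingHom.mem_ker.mpr (by
      rw [awayEval_mk, (hev q).mpr dvd_rfl, zero_div])))
    obtain ⟨n, a, ha, rfl⟩ := Away.mk_surjective 𝒜 hs r
    have hr' : awayEval ev hu (Away.mk 𝒜 hs n a ha) = 0 := hr
    rw [awayEval_mk, div_eq_zero_iff, hev, or_iff_left (pow_ne_zero _ hu.ne_zero)] at hr'
    obtain ⟨b, rfl⟩ := hr'
    -- The cofactor `b` need not be homogeneous. The factor `sᵉ` offsets the degree of `q`, and only
    -- the component in degree `n • m` of `b sᵉ` contributes to the homogeneous product.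
    let b' : A := DirectSum.decompose 𝒜 (b * s ^ e) (n • m)
    have hb' : b' ∈ 𝒜 (n • m) := SetLike.coe_mem _
    have hmem : q * b * s ^ e ∈ 𝒜 (e • m + n • m) := by
      rw [add_comm]
      exact SetLike.mul_mem_graded ha (SetLike.pow_mem_graded e hs)
    have hqb : q * b * s ^ e = q * b' := by
      rw [← DirectSum.coe_decompose_mul_add_of_left_mem 𝒜 hq, ← mul_assoc,
        DirectSum.decompose_of_mem_same 𝒜 hmem]
    rw [Ideal.mem_span_singleton]
    refine ⟨Away.mk 𝒜 hs n b' hb', ?_⟩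
    ext
    rw [val_mul, Away.val_mk, Away.val_mk, Away.val_mk, Localization.mk_mul,
      Localization.mk_eq_mk_iff, Localization.r_iff_exists]
    refine ⟨1, ?_⟩
    simp only [OneMemClass.coe_one, one_mul, Submonoid.mk_mul_mk]
    rw [← hqb]
    ring
  · exact (Ideal.span_singleton_le_iff_mem _).mpr ((hZ' x).mp hx) h

lemma specIdeal_vanishingIdeal_eq_top (Z : TopologicalSpace.Closeds (Proj 𝒜))
    (hZ : Disjoint (Z : Set (Proj 𝒜)) (Proj.basicOpen 𝒜 s)) :
    specIdeal ((Scheme.IdealSheafData.vanishingIdeal Z).comap (Proj.awayι 𝒜 s hs hm)) = ⊤ := by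
  refine eq_top_iff.mpr fun r _ ↦ (mem_specIdeal_comap_vanishingIdeal _ _ _).mpr fun x hx ↦ ?_
  refine (Set.disjoint_left.mp hZ hx ?_).elim
  have : Proj.awayι 𝒜 s hs hm x ∈ (Proj.awayι 𝒜 s hs hm).opensRange := ⟨x, rfl⟩
  rwa [Proj.opensRange_awayι] at this

end ChartIdeal

/-! ### Contact orders -/

section ContactOrder

open HomogeneousLocalization

variable {k : Type u} [Field k]

variable (k) in
/-- The chart of `ℙ¹` around `∞`. -/
def inftyChart : Spec (.of (Polynomial k)) ⟶ (P1Infty k).space :=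
  lineChart k zero_ne_one

instance : IsOpenImmersion (inftyChart k) :=
  inferInstanceAs (IsOpenImmersion (lineChart k zero_ne_one))

lemma inftyChart_toSpec :
    inftyChart k ≫ (P1Infty k).toSpec = Spec.map (CommRingCat.ofHom Polynomial.C) :=
  lineChart_toSpec _

/-- `f^* Δ_W` is supported at `∞`, hence lies in the chart `Spec k[t]` and has ring of functions
`k[t] / (a)`. -/
lemma contactOrder_eq_natDegree {W : Pair k} (f : A1Curve W) {a : Polynomial k}
    (ha : specIdeal ((W.boundaryIdeal.comap f.hom).comap (inftyChart k)) =
      Ideal.span {a}) : f.contactOrder = a.natDegree := by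
  have hsupp : ((W.boundaryIdeal.comap f.hom).support : Set (P1Infty k).space) ⊆
      Set.range (inftyChart k) := by
    rw [Scheme.IdealSheafData.support_comap]
    intro x hx
    have hx₁ : f.hom x ∈ (W.boundary : Set W.space) := by
      have hx' : f.hom x ∈ (W.boundaryIdeal.support : Set W.space) := hx
      rwa [Pair.boundaryIdeal, Scheme.IdealSheafData.coe_support_vanishingIdeal] at hx'
    have hx₂ := (Set.ext_iff.mp f.preimage_boundary x).mp hx₁
    have hx₃ : x ∉ Proj.basicOpen (weightedHomogeneousSubmodule k ![1, 1]) (X 1) :=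
      (mem_zeros_iff _ _ x).mp hx₂
    have hcov : x ∈ ⨆ i, Proj.basicOpen (weightedHomogeneousSubmodule k ![1, 1]) (X i) := by
      rw [iSup_basicOpen_X]; trivial
    obtain ⟨i, hi⟩ := TopologicalSpace.Opens.mem_iSup.mp hcov
    fin_cases i
    · change x ∈ (inftyChart k).opensRange
      have h := opensRange_lineChart (k := k) zero_ne_one
      exact (SetLike.ext_iff.mp h x).mpr hi
    · exact (hx₃ hi).elim
  obtain ⟨π, hπ, hker, hπr⟩ := exists_subscheme_sections (inftyChart k) _ hsupp
  rw [ha] at hker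
  -- The `k`-structure used in `contactOrder` comes from the structure morphism of `ℙ¹`; it has to
  -- be the one of `k[t] / (a)`.
  have hscal (b : k) : f.scalarMap b = π (Polynomial.C b) := by
    let r := (P1Infty k).toSpec.appTop.hom ((Scheme.ΓSpecIso (.of k)).inv.hom b)
    have h₁ : f.scalarMap b = (W.boundaryIdeal.comap f.hom).subschemeι.appTop.hom r := by
      simp only [A1Curve.scalarMap, Scheme.Hom.comp_appTop, CommRingCat.hom_comp]
      rfl
    have h₂ : (Scheme.ΓSpecIso (.of (Polynomial k))).hom.hom ((inftyChart k).appTop.hom r) =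
        Polynomial.C b := by
      have h₃ := congr(($(inftyChart_toSpec (k := k))).appTop ≫
        (Scheme.ΓSpecIso (.of (Polynomial k))).hom)
      rw [Scheme.ΓSpecIso_naturality, Scheme.Hom.comp_appTop] at h₃
      have h₄ := congr(($h₃).hom ((Scheme.ΓSpecIso (.of k)).inv.hom b))
      simp only [CommRingCat.hom_comp, RingHom.comp_apply] at h₄
      rw [h₄]
      simp
    rw [h₁, ← hπr, h₂]
  rw [A1Curve.contactOrder]
  let : Algebra k Γ(f.pullbackBoundary, ⊤) := f.scalarMap.toAlgebra
  let π' : Polynomial k →ₐ[k] Γ(f.pullbackBoundary, ⊤) :=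
    { π with commutes' := fun b ↦ (hscal b).symm }
  have hker' : RingHom.ker π' = Ideal.span {a} := hker
  rw [← (Ideal.quotientKerAlgEquivOfSurjective (f := π') hπ).toLinearEquiv.finrank_eq,
    (Ideal.quotientEquivAlgOfEq k hker').toLinearEquiv.finrank_eq,
    finrank_quotient_span_eq_natDegree]

variable (p : ℕ) [Fact p.Prime] [CharP k p] [PerfectRing k p] (c : ℕ → k)

omit [Fact p.Prime] [CharP k p] [PerfectRing k p] in
-- At the coordinate point with `xᵢ = 1` and the others `0`, `q` vanishes and `xᵢ` does not.
lemma not_sigma_sub_dvd_X (hp : p ≠ 0) {i : Fin 3} (hi : i = 0 ∨ i = 1) :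
    ¬ sigma p c - X 2 ^ p ∣ X i := by
  rintro ⟨r, hr⟩
  have h := congr(eval₂Hom (RingHom.id k) (Pi.single i 1) $hr)
  rw [map_mul, map_sub, eval₂_sigma, Finset.sum_eq_zero] at h
  · rcases hi with rfl | rfl <;> simp [hp] at h
  · intro j hj
    rw [Finset.mem_Icc] at hj
    rcases hi with rfl | rfl
    · simp [show p - j ≠ 0 by omega]
    · simp [show j ≠ 0 by omega]

lemma comap_awayι_eq {m : ℕ} (hm : 0 < m) {s : MvPolynomial (Fin 3) k}
    (hs : s ∈ weightedHomogeneousSubmodule k ![1, 1, 1] m)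
    (hs' : substZX p c s ∈ weightedHomogeneousSubmodule k ![1, 1, p] (p * m))
    (hm' : 0 < p * m)
    (h : (specIdeal ((pairX p c).boundaryIdeal.comap (Proj.awayι _ s hs hm))).map (awayZX p c s) =
      specIdeal ((pairZ k p).boundaryIdeal.comap (Proj.awayι _ _ hs' hm')) ^ p) :
    ((pairX p c).boundaryIdeal.comap (mapZX p c)).comap (Proj.awayι _ _ hs' hm') =
      ((pairZ k p).boundaryIdeal ^ p).comap (Proj.awayι _ _ hs' hm') := by
  refine (Scheme.IdealSheafData.comap_comp _ _ _).symm.trans ?_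
  refine (congrArg _ (awayι_mapZX p c hm hs)).trans ?_
  refine (Scheme.IdealSheafData.comap_comp _ _ _).trans (Eq.trans ?_ (comap_pow _ _ _).symm)
  refine specIdeal_injective ?_
  exact (specIdeal_comap _ _).trans (h.trans (specIdeal_pow _ _).symm)

/-- `F^* Δ_X = p Δ_Z`. Over `D₊(xᵢ)`, `i = 0, 1`, the generators are `q / xᵢᵖ` and `z₂ / zᵢᵖ`, and
`q ↦ z₂ᵖ`. Over `D₊(q)`, whose preimage `D₊(z₂)` contains the vertex `[0 : 0 : 1]`, both ideals are
trivial. -/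
lemma comap_boundaryIdeal (hc₁ : c 1 = 1) :
    (pairX p c).boundaryIdeal.comap (mapZX p c) = (pairZ k p).boundaryIdeal ^ p := by
  have hp : 0 < p := Nat.Prime.pos Fact.out
  have hp' : p ≠ 0 := hp.ne'
  refine idealSheaf_ext_of_awayι (𝒜 := weightedHomogeneousSubmodule k ![1, 1, p]) fun x ↦ ?_
  have hq := sigma_sub_mem p c
  have key {m : ℕ} (hm : 0 < m) {s : MvPolynomial (Fin 3) k}
      (hs : s ∈ weightedHomogeneousSubmodule k ![1, 1, 1] m)
      (hx : mapZX p c x ∈ Proj.basicOpen (weightedHomogeneousSubmodule k ![1, 1, 1]) s) :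
      x ∈ Proj.basicOpen (weightedHomogeneousSubmodule k ![1, 1, p]) (substZX p c s) :=
    (SetLike.ext_iff.mp (mapZX_preimage_basicOpen p c hm hs) x).mp hx
  by_cases hx : mapZX p c x ∈ WProj.zeros k ![1, 1, 1] (sigma p c - X 2 ^ p)
  · obtain ⟨i, hi, hxi⟩ := exists_mem_basicOpen_X p c _ hx
    have hXi := X_mem (k := k) weights_three i
    refine ⟨p * 1, Nat.mul_pos hp one_pos, substZX p c (X i), substZX_mem p c _ _ hXi,
      key one_pos hXi hxi, comap_awayι_eq p c one_pos hXi _ _ ?_⟩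
    have hq' : sigma p c - X 2 ^ p ∈ weightedHomogeneousSubmodule k ![1, 1, 1] (p • 1) := by
      rwa [smul_eq_mul, mul_one]
    have hX₂ : X 2 ∈ weightedHomogeneousSubmodule k ![1, 1, p] (1 • (p * 1)) := by
      rw [one_smul, mul_one]
      exact isWeightedHomogeneous_X k ![1, 1, p] 2
    have hdvd : ¬ X 2 ∣ substZX p c (X i) := by
      rintro ⟨r, hr⟩
      have h := congr(eval₂Hom (RingHom.id k) (Pi.single i 1) $hr)
      rcases hi with rfl | rfl <;> simp [substZX] at h
    have h₁ := specIdeal_vanishingIdeal_eq_span (𝒜 := weightedHomogeneousSubmodule k ![1, 1, 1])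
      one_pos hXi hq' (prime_sigma_sub_X_pow (Nat.Prime.two_le Fact.out) c hc₁)
      (not_sigma_sub_dvd_X p c hp' hi) hp (pairX p c).boundary rfl
    have h₂ := specIdeal_vanishingIdeal_eq_span (𝒜 := weightedHomogeneousSubmodule k ![1, 1, p])
      (Nat.mul_pos hp one_pos) (substZX_mem p c _ _ hXi) hX₂ X_prime hdvd one_pos
      (pairZ k p).boundary rfl
    refine (congrArg (Ideal.map _) h₁).trans (Eq.trans ?_ (congrArg (· ^ p) h₂).symm)
    rw [Ideal.map_span, Set.image_singleton]
    refine Eq.trans ?_ (Ideal.span_singleton_pow _ _).symm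
    refine congrArg (fun y ↦ Ideal.span {y}) ?_
    refine (awayZX_mk p c hXi p _ hq').trans ((awayMk_congr _ (substZX_boundary p c) _).trans ?_)
    refine Eq.trans ?_ (awayMk_pow (substZX_mem p c _ _ hXi) 1 hX₂ p).symm
    congr 1
    exact (one_mul p).symm
  · have hxq := not_not.mp ((mem_zeros_iff _ _ _).not.mp hx)
    refine ⟨p * p, Nat.mul_pos hp hp, substZX p c (sigma p c - X 2 ^ p), substZX_mem p c _ _ hq,
      key hp hq hxq, comap_awayι_eq p c hp hq _ _ ?_⟩
    have h₁ := specIdeal_vanishingIdeal_eq_top (𝒜 := weightedHomogeneousSubmodule k ![1, 1, 1])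
      hp hq (pairX p c).boundary (Set.disjoint_left.mpr fun y hy ↦ (mem_zeros_iff _ _ y).mp hy)
    have h₂ := specIdeal_vanishingIdeal_eq_top (𝒜 := weightedHomogeneousSubmodule k ![1, 1, p])
      (Nat.mul_pos hp hp) (substZX_mem p c _ _ hq) (pairZ k p).boundary
      (Set.disjoint_left.mpr fun y hy hy' ↦ (mem_zeros_iff _ _ y).mp hy (by
        change y ∈ Proj.basicOpen _ (substZX p c (sigma p c - X 2 ^ p)) at hy'
        rwa [substZX_boundary, Proj.basicOpen_pow _ _ _ hp] at hy'))
    refine (congrArg (Ideal.map _) h₁).trans (Eq.trans ?_ (congrArg (· ^ p) h₂).symm)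
    exact (Ideal.map_top _).trans (Ideal.top_pow _ p).symm

/-- Since `k[t]` is principal, `g^* Δ_Z` has one generator `a` near `∞`; then `aᵖ` generates `f^*
Δ_X = g^* F^* Δ_X`. -/
theorem contactOrder_eq_mul (hc₁ : c 1 = 1) {f : A1Curve (pairX p c)} {g : A1Curve (pairZ k p)}
    (h : g.hom ≫ mapZX p c = f.hom) : f.contactOrder = p * g.contactOrder := by
  obtain ⟨a, ha⟩ : ∃ a, specIdeal (((pairZ k p).boundaryIdeal.comap g.hom).comap
      (inftyChart k)) = Ideal.span {a} :=
    (IsPrincipalIdealRing.principal (R := Polynomial k) _).principal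
  have hf : specIdeal (((pairX p c).boundaryIdeal.comap f.hom).comap
      (inftyChart k)) = Ideal.span {a ^ p} := by
    rw [← h, Scheme.IdealSheafData.comap_comp, comap_boundaryIdeal p c hc₁, comap_pow, comap_pow,
      specIdeal_pow, ha, Ideal.span_singleton_pow]
  rw [contactOrder_eq_natDegree f hf, contactOrder_eq_natDegree g ha, Polynomial.natDegree_pow]

end ContactOrder

end

end A1Curves

theorem proposition2p2 {k : Type u} [Field k] [IsAlgClosed k] (p : ℕ) [Fact p.Prime] [CharP k p]
    (c : ℕ → k) (hc₁ : c 1 = 1) (hc₂ : c (p - 1) = 1)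
    (f : A1Curves.A1Curve (A1Curves.pairX p c)) :
    (∃! g : A1Curves.A1Curve (A1Curves.pairZ k p), g.hom ≫ A1Curves.mapZX p c = f.hom) ∧
      ∀ g : A1Curves.A1Curve (A1Curves.pairZ k p), g.hom ≫ A1Curves.mapZX p c = f.hom →
        f.contactOrder = p * g.contactOrder := by
  obtain ⟨g, hg⟩ := A1Curves.exists_a1Curve_lift p c hc₁ hc₂ f
  exact ⟨⟨g, hg, fun g' hg' ↦ A1Curves.a1Curve_lift_unique p c (hg'.trans hg.symm)⟩,
    fun g hg ↦ A1Curves.contactOrder_eq_mul p c hc₁ hg⟩
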